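/- Graphs are undirected and simple, possibly infinite and not necessarily locally finite. A connected graph $X$ has \emph{connectivity} $1$ if it has a vertex $x$ such that $X\setminus x$ is not connected. The \emph{blocks} of $X$ are the maximal connected subgraphs of $X$ that do not have connectivity $1$. A graph $X$ is \emph{primitive} if the only $\operatorname{Aut}X$-invariant equivalence relations on its vertex set are the trivial one (all classes are singletons) and the universal one (there is only one class). Let $X$ be a primitive graph with connectivity $1$. If each vertex of $X$ is contained in more than two (possibly infinitely many) blocks, then the group $\operatorname{Aut}X$ is simple. If each vertex of $X$ is contained in exactly two blocks, then $\operatorname{Aut}X$ has a normal subgroup of index $2$ that is a simple group. -/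

import Mathlib

namespace SimpleGraph

/-- A graph is primitive if the only equivalence relations on its vertex set that are invariant
under the automorphism group are the trivial one (`⊥`, equality) and the universal one (`⊤`). -/
def IsPrimitive {V : Type*} (X : SimpleGraph V) : Prop :=
  ∀ r : Setoid V, (∀ (g : X ≃g X) (u v : V), r u v → r (g u) (g v)) → r = ⊥ ∨ r = ⊤

/-- A vertex whose deletion leaves a disconnected graph, that is, a graph with two vertices not
joined by a walk. (The empty graph, left over from a one-vertex graph, is not disconnected.) -/
def IsCutvertex {V : Type*} (X : SimpleGraph V) (x : V) : Prop :=
  ¬ (X.induce ({x}ᶜ : Set V)).Preconnected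

/-- A connected graph has connectivity 1 if it has a cutvertex. -/
def HasConnectivityOne {V : Type*} (X : SimpleGraph V) : Prop :=
  X.Connected ∧ ∃ x : V, X.IsCutvertex x

/-- The blocks of a graph: the maximal connected subgraphs that do not have connectivity 1. -/
def IsBlock {V : Type*} (X : SimpleGraph V) (B : X.Subgraph) : Prop :=
  Maximal (fun H : X.Subgraph => H.Connected ∧ ¬ H.coe.HasConnectivityOne) B

/-- The set of blocks that contain a given vertex. -/
def blocksAt {V : Type*} (X : SimpleGraph V) (x : V) : Set X.Subgraph :=
  {B | X.IsBlock B ∧ x ∈ B.verts}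

end SimpleGraph

/-! The argument follows Tits' simplicity theorem for groups acting on trees. Everything happens in
the block tree, whose vertices are the vertices and the blocks of `X`; its edges at `x` (the flags)
correspond to the components of `X ∖ x`. The tree itself is never built: `JoinedAvoiding` describes
its branches and `Unseparated` its blocks.

Let `N` be normalized by a block-transitive group `Γ` that contains all flag stabilizers, and
suppose that `N` fixes no vertex. Then `N` contains translations along axes through any given flag.
An automorphism `u` supported on a branch off such an axis is a commutator `w * g * w⁻¹ * g⁻¹` of
the translation `g` with the infinite product `w` of the conjugates of `u` by `g ^ n`, and so lies
in `N`. Every flag stabilizer is generated by automorphisms supported on branches, hence lies in `N`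
(`mem_of_fixesFlag`).

Primitivity supplies the hypotheses: an invariant relation that is an equivalence on each block is
trivial or full on all blocks (`IsPrimitive.eq_or_forall_unseparated`). This yields blocks with at
least three vertices and transitivity on blocks.

With at least three components at each vertex, vertex stabilizers are generated by flag stabilizers,
and a nontrivial normal subgroup is transitive, so it is everything. With exactly two, the blocks
are 2-coloured like the edges of a path; the colour-preserving automorphisms have index two, and in
this subgroup vertex stabilizers are flag stabilizers. It remains to find a nontrivial flag
stabilizer (`exists_fixesFlag_ne_one`). -/

namespace SimpleGraph

variable {V : Type*} {X : SimpleGraph V}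

/-! ### Separation by a single vertex, and blocks as vertex sets -/

/-- `u` and `v` are joined by a walk that does not visit `x`. -/
def JoinedAvoiding (X : SimpleGraph V) (x u v : V) : Prop :=
  ∃ p : X.Walk u v, x ∉ p.support

/-- No third vertex separates `u` from `v`. -/
def Unseparated (X : SimpleGraph V) (u v : V) : Prop :=
  ∀ z, z ≠ u → z ≠ v → X.JoinedAvoiding z u v

/-- The vertices that no vertex separates from `u` or from `v`; for distinct unseparated `u` and
`v` these are the vertices of the block that contains both. -/
def blockSet (X : SimpleGraph V) (u v : V) : Set V :=
  {w | X.Unseparated u w ∧ X.Unseparated v w}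

namespace JoinedAvoiding

variable {x u v w : V}

theorem symm (h : X.JoinedAvoiding x u v) : X.JoinedAvoiding x v u := by
  obtain ⟨p, hp⟩ := h
  exact ⟨p.reverse, by simpa using hp⟩

theorem trans (h : X.JoinedAvoiding x u v) (h' : X.JoinedAvoiding x v w) :
    X.JoinedAvoiding x u w := by
  obtain ⟨p, hp⟩ := h
  obtain ⟨q, hq⟩ := h'
  exact ⟨p.append q, by simp [Walk.mem_support_append_iff, hp, hq]⟩

theorem ne_left (h : X.JoinedAvoiding x u v) : u ≠ x := by
  obtain ⟨p, hp⟩ := h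
  rintro rfl
  exact hp p.start_mem_support

theorem ne_right (h : X.JoinedAvoiding x u v) : v ≠ x := h.symm.ne_left

theorem refl (h : u ≠ x) : X.JoinedAvoiding x u u := ⟨Walk.nil, by simpa using h.symm⟩

theorem of_adj (h : X.Adj u v) (hu : u ≠ x) (hv : v ≠ x) : X.JoinedAvoiding x u v :=
  ⟨h.toWalk, by simp [hu.symm, hv.symm]⟩

theorem map (g : X ≃g X) (h : X.JoinedAvoiding x u v) :
    X.JoinedAvoiding (g x) (g u) (g v) := by
  obtain ⟨p, hp⟩ := h
  refine ⟨p.map g.toHom, ?_⟩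
  rw [Walk.support_map]
  intro hx
  obtain ⟨y, hy, hyx⟩ := List.mem_map.1 hx
  exact hp (g.injective hyx ▸ hy)

end JoinedAvoiding

section Basic

variable {x y u v w : V}

@[simp] theorem not_joinedAvoiding_left : ¬ X.JoinedAvoiding x x v := fun h => h.ne_left rfl

@[simp] theorem not_joinedAvoiding_right : ¬ X.JoinedAvoiding x u x := fun h => h.ne_right rfl

theorem joinedAvoiding_map_iff (g : X ≃g X) :
    X.JoinedAvoiding (g x) (g u) (g v) ↔ X.JoinedAvoiding x u v :=
  ⟨fun h => by simpa using h.map g.symm, .map g⟩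

/-- Of two distinct vertices, one can be reached from `v` without visiting the other. -/
theorem Connected.joinedAvoiding_or (hX : X.Connected) (hxy : x ≠ y) (v : V) :
    X.JoinedAvoiding y x v ∨ X.JoinedAvoiding x y v := by
  classical
  obtain ⟨p⟩ := hX.preconnected x v
  set q := p.toPath
  by_cases hy : y ∈ q.1.support
  · right
    refine ⟨q.1.dropUntil y hy, fun hx => ?_⟩
    have hnd := q.2.support_nodup
    rw [← q.1.take_spec hy, Walk.support_append] at hnd
    have hxs : x ∈ (q.1.dropUntil y hy).support.tail := by
      rw [← Walk.cons_tail_support, List.mem_cons] at hx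
      exact hx.resolve_left hxy
    exact (List.nodup_append.1 hnd).2.2 x (Walk.start_mem_support _) x hxs rfl
  · exact .inl ⟨q.1, hy⟩

theorem exists_adj_joinedAvoiding (hX : X.Connected) (h : v ≠ x) :
    ∃ z, X.Adj x z ∧ X.JoinedAvoiding x z v := by
  classical
  obtain ⟨p⟩ := hX.preconnected x v
  obtain ⟨p, hp⟩ := p.toPath
  cases p with
  | nil => exact absurd rfl h
  | cons hadj q => exact ⟨_, hadj, q, ((Walk.cons_isPath_iff _ _).1 hp).2⟩

theorem Unseparated.symm (h : X.Unseparated u v) : X.Unseparated v u :=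
  fun z hv hu => (h z hu hv).symm

@[simp] theorem Unseparated.refl (u : V) : X.Unseparated u u :=
  fun _ hz _ => .refl hz.symm

theorem Adj.unseparated (h : X.Adj u v) : X.Unseparated u v :=
  fun _ hu hv => .of_adj h hu.symm hv.symm

theorem Unseparated.map (g : X ≃g X) (h : X.Unseparated u v) : X.Unseparated (g u) (g v) := by
  intro z hu hv
  have := h (g⁻¹ z) (by rintro rfl; simp at hu) (by rintro rfl; simp at hv)
  simpa using this.map g

theorem unseparated_map_iff (g : X ≃g X) : X.Unseparated (g u) (g v) ↔ X.Unseparated u v :=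
  ⟨fun h => by simpa using h.map g.symm, .map g⟩

/-- Neighbours of `x` in the block tree on the same side of `x` are unseparated. -/
theorem Unseparated.of_joinedAvoiding (hu : X.Unseparated x u) (hv : X.Unseparated x v)
    (h : X.JoinedAvoiding x u v) : X.Unseparated u v := by
  intro z hzu hzv
  by_cases hzx : z = x
  · exact hzx ▸ h
  · exact (hu z hzx hzu).symm.trans (hv z hzx hzv)

/-- A separating vertex differs from `x` or from `y`, so `u` and `v` can be joined through that one.
-/
theorem unseparated_of_mem_blockSet (hxy : x ≠ y) (hu : u ∈ X.blockSet x y)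
    (hv : v ∈ X.blockSet x y) : X.Unseparated u v := by
  intro z hzu hzv
  by_cases hzx : z = x
  · have hzy : z ≠ y := hzx ▸ hxy
    exact (hu.2 z hzy hzu).symm.trans (hv.2 z hzy hzv)
  · exact (hu.1 z hzx hzu).symm.trans (hv.1 z hzx hzv)

theorem left_mem_blockSet (h : X.Unseparated x y) : x ∈ X.blockSet x y := ⟨.refl x, h.symm⟩

theorem right_mem_blockSet (h : X.Unseparated x y) : y ∈ X.blockSet x y := ⟨h, .refl y⟩

theorem blockSet_comm (x y : V) : X.blockSet x y = X.blockSet y x := by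
  ext w
  exact and_comm

theorem blockSet_eq_of_mem (hxy : x ≠ y) (huv : u ≠ v)
    (hu : u ∈ X.blockSet x y) (hv : v ∈ X.blockSet x y) : X.blockSet u v = X.blockSet x y := by
  have key : ∀ {x y u v : V}, x ≠ y → u ∈ X.blockSet x y → v ∈ X.blockSet x y →
      X.blockSet x y ⊆ X.blockSet u v := fun hxy hu hv w hw =>
    ⟨unseparated_of_mem_blockSet hxy hu hw, unseparated_of_mem_blockSet hxy hv hw⟩
  refine (key huv ?_ ?_).antisymm (key hxy hu hv)
  · exact ⟨hu.1.symm, hv.1.symm⟩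
  · exact ⟨hu.2.symm, hv.2.symm⟩

theorem map_mem_blockSet_iff (g : X ≃g X) : g w ∈ X.blockSet (g u) (g v) ↔ w ∈ X.blockSet u v := by
  simp [blockSet, unseparated_map_iff]

/-- An automorphism that maps two distinct vertices of a block into the block preserves it. -/
theorem map_mem_blockSet_iff_of_mem (g : X ≃g X) (hxy : x ≠ y)
    (huv : u ≠ v) (hu : u ∈ X.blockSet x y) (hv : v ∈ X.blockSet x y)
    (hgu : g u ∈ X.blockSet x y) (hgv : g v ∈ X.blockSet x y) :
    g w ∈ X.blockSet x y ↔ w ∈ X.blockSet x y := by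
  conv_lhs => rw [← blockSet_eq_of_mem hxy (g.injective.ne huv) hgu hgv]
  rw [map_mem_blockSet_iff, blockSet_eq_of_mem hxy huv hu hv]

/-- Paths between unseparated vertices stay in their block. -/
theorem Unseparated.of_mem_support (h : X.Unseparated u v) (p : X.Walk u v) (hp : p.IsPath)
    (hw : w ∈ p.support) : X.Unseparated u w := by
  classical
  intro z hzu hzw
  -- If `z` lies on the path before `w`, it does not lie after `w`; so go from `u` to `v` around `z`
  -- and return along the path to `w`.
  by_cases hz : z ∈ (p.takeUntil w hw).support
  · have hnd := hp.support_nodup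
    rw [← p.take_spec hw, Walk.support_append] at hnd
    have hzd : z ∉ (p.dropUntil w hw).support := by
      intro hz'
      rw [← Walk.cons_tail_support, List.mem_cons] at hz'
      exact (List.nodup_append.1 hnd).2.2 z hz z (hz'.resolve_left hzw) rfl
    have hzv : z ≠ v := by
      rintro rfl
      exact hzd (Walk.end_mem_support _)
    exact (h z hzu hzv).trans (JoinedAvoiding.symm ⟨_, hzd⟩)
  · exact ⟨_, hz⟩

theorem Unseparated.mem_blockSet_of_mem_support (h : X.Unseparated u v) (p : X.Walk u v)
    (hp : p.IsPath) (hw : w ∈ p.support) : w ∈ X.blockSet u v :=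
  ⟨h.of_mem_support p hp hw, h.symm.of_mem_support p.reverse hp.reverse (by simpa using hw)⟩

end Basic

/-! ### Projection of vertices to a block -/

section Gate

variable {x y u v w a b p q : V}

/-- The vertex of the block on `x` and `y` through which the block is reached from `v`. -/
def IsGate (X : SimpleGraph V) (x y p v : V) : Prop :=
  p ∈ X.blockSet x y ∧ ∀ t ∈ X.blockSet x y, ¬ X.JoinedAvoiding p t v

theorem isGate_self (h : v ∈ X.blockSet x y) : X.IsGate x y v v := ⟨h, by simp⟩

theorem IsGate.eq (hX : X.Connected) (hp : X.IsGate x y p v) (hq : X.IsGate x y q v) : p = q := by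
  by_contra hne
  exact (hX.joinedAvoiding_or hne v).elim (hq.2 p hp.1) (hp.2 q hq.1)

/-- Along a walk starting in the block, the gate changes only on edges that lie inside the block. -/
theorem exists_isGate (hX : X.Connected) (hxy : x ≠ y) (h : X.Unseparated x y) (v : V) :
    ∃ p, X.IsGate x y p v := by
  obtain ⟨W⟩ := hX.preconnected v x
  induction W with
  | nil => exact ⟨_, isGate_self (left_mem_blockSet h)⟩
  | @cons v' v x hadj _ ih =>
    obtain ⟨p, hp⟩ := ih hxy h
    by_cases hv'p : v' = p
    · subst hv'p
      exact ⟨v', isGate_self hp.1⟩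
    by_cases hvp : v = p
    · subst hvp
      by_cases hv' : v' ∈ X.blockSet x y
      · exact ⟨v', isGate_self hv'⟩
      refine ⟨v, hp.1, fun t ht hj => hv' ?_⟩
      have htv' : X.Unseparated t v' :=
        (unseparated_of_mem_blockSet hxy hp.1 ht).of_joinedAvoiding hadj.symm.unseparated hj
      rw [← blockSet_eq_of_mem hxy hj.ne_left ht hp.1]
      exact ⟨htv', hadj.symm.unseparated⟩
    · exact ⟨p, hp.1, fun t ht hj => hp.2 t ht (hj.trans (.of_adj hadj hv'p hvp))⟩

/-- Unseparated vertices with distinct gates lie in the block. -/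
theorem IsGate.eq_of_unseparated (hX : X.Connected) (hab : X.Unseparated a b)
    (hp : X.IsGate x y p a) (hq : X.IsGate x y q b) (hpq : p ≠ q) : a = p := by
  by_contra hap
  have hbp : b ≠ p := by
    rintro rfl
    exact hpq ((isGate_self hp.1).eq hX hq)
  exact hpq (IsGate.eq hX ⟨hp.1, fun t ht hj => hp.2 t ht (hj.trans
    (hab p (Ne.symm hap) hbp.symm).symm)⟩ hq)

end Gate

/-! ### Primitivity tested inside blocks -/

section Primitive

/-- An invariant relation that is an equivalence relation on each block is trivial or contains all
pairs of vertices that lie in a common block. -/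
theorem IsPrimitive.eq_or_forall_unseparated (hprim : X.IsPrimitive) (hX : X.Connected)
    (r : V → V → Prop) (hrefl : ∀ u, r u u) (hsymm : ∀ u v, r u v → r v u)
    (htrans : ∀ u v w, r u v → r v w → X.Unseparated u w → r u w)
    (hr : ∀ u v, r u v → X.Unseparated u v) (hinv : ∀ (g : X ≃g X) u v, r u v → r (g u) (g v)) :
    (∀ u v, r u v → u = v) ∨ ∀ u v, X.Unseparated u v → r u v := by
  rcases hprim (Relation.EqvGen.setoid r) (by
    intro g u v huv
    induction huv with
    | rel _ _ h => exact .rel _ _ (hinv g _ _ h)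
    | refl => exact .refl _
    | symm _ _ _ ih => exact .symm _ _ ih
    | trans _ _ _ _ _ ih ih' => exact .trans _ _ _ ih ih') with hs | hs
  · left
    intro u v huv
    have : Relation.EqvGen.setoid r u v := .rel _ _ huv
    rwa [hs] at this
  · right
    intro u v huv
    by_cases hne : u = v
    · exact hne ▸ hrefl u
    -- Projection to the block retracts the generated equivalence to `r`: a generating pair with
    -- distinct gates lies inside the block, and transitivity of `r` is needed only there.
    have key : ∀ a b, Relation.EqvGen r a b → ∀ p q, X.IsGate u v p a → X.IsGate u v q b →
        r p q := by
      intro a b hab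
      induction hab with
      | rel a b h =>
        intro p q hp hq
        by_cases hpq : p = q
        · exact hpq ▸ hrefl p
        · have hab := hr a b h
          rwa [hp.eq_of_unseparated hX hab hq hpq,
            hq.eq_of_unseparated hX hab.symm hp (Ne.symm hpq)] at h
      | refl a =>
        intro p q hp hq
        exact hp.eq hX hq ▸ hrefl p
      | symm a b _ ih => exact fun p q hp hq => hsymm _ _ (ih q p hq hp)
      | trans a b c _ _ ih ih' =>
        intro p q hp hq
        obtain ⟨s, hs⟩ := exists_isGate hX hne huv b
        exact htrans _ _ _ (ih p s hp hs) (ih' s q hs hq)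
          (unseparated_of_mem_blockSet hne hp.1 hq.1)
    have huv' : Relation.EqvGen.setoid r u v := by
      rw [hs]
      trivial
    exact key u v huv' u v (isGate_self (left_mem_blockSet huv))
      (isGate_self (right_mem_blockSet huv))

end Primitive

/-! ### Automorphisms assembled from pieces -/

section Glue

theorem exists_automorphism (φ ψ : V → V) (h₁ : ∀ v, ψ (φ v) = v) (h₂ : ∀ v, φ (ψ v) = v)
    (hφ : ∀ u v, X.Adj u v → X.Adj (φ u) (φ v)) (hψ : ∀ u v, X.Adj u v → X.Adj (ψ u) (ψ v)) :
    ∃ g : X ≃g X, ∀ v, g v = φ v :=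
  ⟨⟨⟨φ, ψ, h₁, h₂⟩, fun {u v} => ⟨fun h => by simpa [h₁] using hψ _ _ h, hφ u v⟩⟩, fun _ => rfl⟩

/-- All vertices outside `D` are fixed by `u`. -/
def SupportedOn (u : X ≃g X) (D : Set V) : Prop := ∀ v, v ∉ D → u v = v

theorem SupportedOn.map_mem_iff {u : X ≃g X} {D : Set V} (h : SupportedOn u D) {v : V} :
    u v ∈ D ↔ v ∈ D := by
  constructor
  · intro hv
    by_contra hv'
    exact hv' (h v hv' ▸ hv)
  · intro hv
    by_contra hv'
    have := u.injective (h _ hv')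
    exact hv' (this.symm ▸ hv)

theorem SupportedOn.inv {u : X ≃g X} {D : Set V} (h : SupportedOn u D) : SupportedOn u⁻¹ D := by
  intro v hv
  rw [← u.injective.eq_iff, RelIso.apply_inv_self, h v hv]

/-- Automorphisms with pairwise disjoint supports have a common (possibly infinite) product. -/
theorem exists_automorphism_of_disjoint {ι : Type*} (D : ι → Set V) (u : ι → X ≃g X)
    (hD : ∀ i j v, v ∈ D i → v ∈ D j → i = j) (hu : ∀ i, SupportedOn (u i) (D i)) :
    ∃ w : X ≃g X, (∀ i, ∀ v ∈ D i, w v = u i v) ∧ ∀ v, (∀ i, v ∉ D i) → w v = v := by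
  classical
  let F : (ι → X ≃g X) → V → V := fun u v => if h : ∃ i, v ∈ D i then u h.choose v else v
  have hF : ∀ u i v, v ∈ D i → F u v = u i v := by
    intro u i v hv
    have h : ∃ i, v ∈ D i := ⟨i, hv⟩
    simp only [F, dif_pos h, hD _ _ v h.choose_spec hv]
  have hF' : ∀ u v, (∀ i, v ∉ D i) → F u v = v := by
    intro u v hv
    simp only [F, dif_neg (not_exists.2 hv)]
  have hhom : ∀ u : ι → X ≃g X, (∀ i, SupportedOn (u i) (D i)) →
      ∀ a b, X.Adj a b → X.Adj (F u a) (F u b) := by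
    intro u hu a b hab
    by_cases ha : ∃ i, a ∈ D i <;> by_cases hb : ∃ i, b ∈ D i
    · obtain ⟨i, hi⟩ := ha
      obtain ⟨j, hj⟩ := hb
      rw [hF u i a hi, hF u j b hj]
      by_cases hij : i = j
      · subst hij
        exact (u i).map_adj_iff.2 hab
      · have h1 : u i b = b := hu i b fun h => hij (hD _ _ b h hj)
        have h2 : u j (u i a) = u i a :=
          hu j _ fun h => hij (hD _ _ _ ((hu i).map_mem_iff.2 hi) h)
        have h3 := (u j).map_adj_iff.2 ((u i).map_adj_iff.2 hab)
        rwa [h1, h2] at h3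
    · obtain ⟨i, hi⟩ := ha
      rw [hF u i a hi, hF' u b (not_exists.1 hb), ← hu i b (not_exists.1 hb i)]
      exact (u i).map_adj_iff.2 hab
    · obtain ⟨j, hj⟩ := hb
      rw [hF u j b hj, hF' u a (not_exists.1 ha), ← hu j a (not_exists.1 ha j)]
      exact (u j).map_adj_iff.2 hab
    · rwa [hF' u a (not_exists.1 ha), hF' u b (not_exists.1 hb)]
  have hinv : ∀ u u' : ι → X ≃g X, (∀ i, SupportedOn (u i) (D i)) → (∀ i v, u' i (u i v) = v) →
      ∀ v, F u' (F u v) = v := by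
    intro u u' hu huu v
    by_cases hv : ∃ i, v ∈ D i
    · obtain ⟨i, hi⟩ := hv
      rw [hF u i v hi, hF u' i _ ((hu i).map_mem_iff.2 hi), huu]
    · rw [hF' u v (not_exists.1 hv), hF' u' v (not_exists.1 hv)]
  obtain ⟨w, hw⟩ := exists_automorphism (F u) (F fun i => (u i)⁻¹)
    (hinv _ _ hu fun i => (u i).inv_apply_self)
    (hinv _ _ (fun i => (hu i).inv) fun i => (u i).apply_inv_self)
    (hhom u hu) (hhom _ fun i => (hu i).inv)
  exact ⟨w, fun i v hv => (hw v).trans (hF u i v hv), fun v hv => (hw v).trans (hF' u v hv)⟩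

/-- An automorphism that fixes `x` and preserves a union `U` of components of `X ∖ x` can be
replaced by the identity outside `U`. -/
theorem exists_automorphism_restrict (g : X ≃g X) {x : V} (hx : g x = x) (U : Set V)
    (hU : ∀ u v, X.JoinedAvoiding x u v → u ∈ U → v ∈ U) (hgU : ∀ v, g v ∈ U ↔ v ∈ U) :
    ∃ w : X ≃g X, (∀ v ∈ U, w v = g v) ∧ SupportedOn w U := by
  classical
  let F : (X ≃g X) → V → V := fun g v => if v ∈ U then g v else v
  have hcross : ∀ a b, X.Adj a b → a ∈ U → b ∉ U → a = x ∨ b = x := by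
    intro a b hab ha hb
    by_contra hne
    rw [not_or] at hne
    exact hb (hU a b (.of_adj hab hne.1 hne.2) ha)
  have hgU' : ∀ v, g⁻¹ v ∈ U ↔ v ∈ U := fun v => by rw [← hgU, RelIso.apply_inv_self]
  have hx' : g⁻¹ x = x := by rw [← g.injective.eq_iff, RelIso.apply_inv_self, hx]
  have hFpos : ∀ (g : X ≃g X) v, v ∈ U → F g v = g v := fun g v hv => if_pos hv
  have hFneg : ∀ (g : X ≃g X) v, v ∉ U → F g v = v := fun g v hv => if_neg hv
  have hFx : ∀ g : X ≃g X, g x = x → F g x = x := fun g hx => by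
    by_cases h : x ∈ U
    · rw [hFpos _ _ h, hx]
    · exact hFneg _ _ h
  have half : ∀ g : X ≃g X, g x = x → ∀ a b, X.Adj a b → a ∈ U → b ∉ U →
      X.Adj (F g a) (F g b) := by
    intro g hx a b hab ha hb
    rcases hcross a b hab ha hb with rfl | rfl
    · rwa [hFx g hx, hFneg _ _ hb]
    · rw [hFx g hx, hFpos _ _ ha]
      simpa [hx] using g.map_adj_iff.2 hab
  have hhom : ∀ g : X ≃g X, g x = x → ∀ a b, X.Adj a b → X.Adj (F g a) (F g b) := by
    intro g hx a b hab
    by_cases ha : a ∈ U <;> by_cases hb : b ∈ U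
    · rw [hFpos _ _ ha, hFpos _ _ hb]
      exact g.map_adj_iff.2 hab
    · exact half g hx a b hab ha hb
    · exact (half g hx b a hab.symm hb ha).symm
    · rwa [hFneg _ _ ha, hFneg _ _ hb]
  have hinv : ∀ g g' : X ≃g X, (∀ v, g v ∈ U ↔ v ∈ U) → (∀ v, g' (g v) = v) →
      ∀ v, F g' (F g v) = v := by
    intro g g' hg hgg v
    by_cases hv : v ∈ U
    · rw [hFpos _ _ hv, hFpos _ _ ((hg v).2 hv), hgg]
    · rw [hFneg _ _ hv, hFneg _ _ hv]
  obtain ⟨w, hw⟩ := exists_automorphism (F g) (F g⁻¹) (hinv _ _ hgU fun v => by simp)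
    (hinv _ _ hgU' fun v => by simp) (hhom g hx) (hhom _ hx')
  exact ⟨w, fun v hv => (hw v).trans (hFpos _ _ hv), fun v hv => (hw v).trans (hFneg _ _ hv)⟩

/-- An automorphism that fixes `x` and moves one component of `X ∖ x` to another gives rise to one
that exchanges the two and fixes everything else. -/
theorem exists_automorphism_swap (g : X ≃g X) {x v : V} (hx : g x = x)
    (hv : ¬ X.JoinedAvoiding x v (g v)) :
    ∃ s : X ≃g X, s x = x ∧ (∀ w, X.JoinedAvoiding x v w → s w = g w) ∧
      ∀ w, ¬ X.JoinedAvoiding x v w → ¬ X.JoinedAvoiding x (g v) w → s w = w := by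
  classical
  let φ : V → V := fun w => if X.JoinedAvoiding x v w then g w else
    if X.JoinedAvoiding x (g v) w then g⁻¹ w else w
  have hx' : g⁻¹ x = x := by rw [← g.injective.eq_iff, RelIso.apply_inv_self, hx]
  have hg : ∀ w, X.JoinedAvoiding x v w → X.JoinedAvoiding x (g v) (g w) := fun w hw => by
    simpa [hx] using hw.map g
  have hg' : ∀ w, X.JoinedAvoiding x (g v) w → X.JoinedAvoiding x v (g⁻¹ w) := fun w hw => by
    simpa [hx'] using hw.map g⁻¹
  have hdis : ∀ w, X.JoinedAvoiding x (g v) w → ¬ X.JoinedAvoiding x v w :=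
    fun w h h' => hv (h'.trans h.symm)
  have h1 : ∀ w, X.JoinedAvoiding x v w → φ w = g w := fun w h => if_pos h
  have h2 : ∀ w, X.JoinedAvoiding x (g v) w → φ w = g⁻¹ w := fun w h => by
    simp only [φ, if_neg (hdis w h), if_pos h]
  have h3 : ∀ w, ¬ X.JoinedAvoiding x v w → ¬ X.JoinedAvoiding x (g v) w → φ w = w :=
    fun w h h' => by simp only [φ, if_neg h, if_neg h']
  have hφx : φ x = x := h3 x (by simp) (by simp)
  have hinv : ∀ w, φ (φ w) = w := by
    intro w
    by_cases hw : X.JoinedAvoiding x v w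
    · rw [h1 w hw, h2 _ (hg w hw)]
      simp
    by_cases hw' : X.JoinedAvoiding x (g v) w
    · rw [h2 w hw', h1 _ (hg' w hw')]
      simp
    · rw [h3 w hw hw', h3 w hw hw']
  -- On each component of `X ∖ x`, `φ` agrees with `g`, `g⁻¹` or the identity, all of which fix `x`;
  -- no edge joins two components.
  have hlocal : ∀ a b, (a = b ∨ X.JoinedAvoiding x a b) →
      ∃ k : X ≃g X, k x = x ∧ k a = φ a ∧ k b = φ b := by
    intro a b hab
    have hab' : ∀ c, X.JoinedAvoiding x c a ↔ X.JoinedAvoiding x c b := by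
      rcases hab with rfl | hab
      · simp
      · exact fun c => ⟨fun h => h.trans hab, fun h => h.trans hab.symm⟩
    by_cases ha : X.JoinedAvoiding x v a
    · exact ⟨g, hx, (h1 a ha).symm, (h1 b ((hab' _).1 ha)).symm⟩
    by_cases ha' : X.JoinedAvoiding x (g v) a
    · exact ⟨g⁻¹, hx', (h2 a ha').symm, (h2 b ((hab' _).1 ha')).symm⟩
    · exact ⟨1, rfl, (h3 a ha ha').symm, (h3 b (mt (hab' _).2 ha) (mt (hab' _).2 ha')).symm⟩
  have hhom : ∀ a b, X.Adj a b → X.Adj (φ a) (φ b) := by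
    intro a b hab
    by_cases ha : a = x
    · obtain ⟨k, hkx, -, hkb⟩ := hlocal b b (.inl rfl)
      rw [ha, hφx, ← hkb, ← hkx]
      exact k.map_adj_iff.2 (ha ▸ hab)
    by_cases hb : b = x
    · obtain ⟨k, hkx, -, hka⟩ := hlocal a a (.inl rfl)
      rw [hb, hφx, ← hka, ← hkx]
      exact k.map_adj_iff.2 (hb ▸ hab)
    · obtain ⟨k, -, hka, hkb⟩ := hlocal a b (.inr (.of_adj hab ha hb))
      rw [← hka, ← hkb]
      exact k.map_adj_iff.2 hab
  obtain ⟨s, hs⟩ := exists_automorphism φ φ hinv hinv hhom hhom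
  exact ⟨s, (hs x).trans hφx, fun w hw => (hs w).trans (h1 w hw),
    fun w hw hw' => (hs w).trans (h3 w hw hw')⟩

end Glue

/-! ### Translations, and commutators with them -/

section Translation

variable {x v : V} {g k : X ≃g X}

/-- The path in the block tree from `x` over `g x` to `(g * k) x` does not backtrack at `g x`,
because its image under `g⁻¹` does not backtrack at `x`. -/
theorem joinedAvoiding_mul (hX : X.Connected) (hg : g x ≠ x) (h : ¬ X.JoinedAvoiding x (k x)
    (g⁻¹ x)) :
    X.JoinedAvoiding x (g x) ((g * k) x) := by
  refine (hX.joinedAvoiding_or hg _).resolve_right fun h' => h ?_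
  have := h'.map g⁻¹
  simpa [RelIso.mul_apply] using this.symm

/-- If the `N`-orbit of a cutvertex `x` meets all components of `X ∖ x`, then `N` contains, for each
component, a translation whose axis passes through `x` and comes in from that component. -/
theorem exists_translation (hX : X.Connected) {N : Subgroup (X ≃g X)}
    (hcut : ∀ v, ∃ c, c ≠ x ∧
      ¬ X.JoinedAvoiding x v c) (horb : ∀ v, v ≠ x → ∃ h ∈ N, X.JoinedAvoiding x (h x) v)
    (hv : v ≠ x) :
    ∃ g ∈ N, X.JoinedAvoiding x (g⁻¹ x) v ∧ ¬ X.JoinedAvoiding x (g x) v := by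
  obtain ⟨h, hN, hh⟩ := horb v hv
  by_cases hh' : X.JoinedAvoiding x (h⁻¹ x) v
  swap
  · exact ⟨h⁻¹, N.inv_mem hN, by simpa using hh, hh'⟩
  obtain ⟨c, hc, hvc⟩ := hcut v
  obtain ⟨k, kN, hk⟩ := horb c hc
  have hkv : ¬ X.JoinedAvoiding x (k x) v := fun h' => hvc (h'.symm.trans hk)
  by_cases hk' : X.JoinedAvoiding x (k⁻¹ x) v
  · exact ⟨k, kN, hk', hkv⟩
  -- Now `h x` and `h⁻¹ x` both lie on the side of `v`, while `k x` and `k⁻¹ x` do not. So `(k * h)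
  -- x` lies on the side of `k x` and its inverse image of `x` on the side of `h⁻¹ x`.
  have hne : ¬ X.JoinedAvoiding x (h x) (k⁻¹ x) := fun h' => hk' (h'.symm.trans hh)
  have e1 := joinedAvoiding_mul hX hk.ne_left hne
  have e2 := joinedAvoiding_mul hX (g := h⁻¹) (k := k⁻¹) hh'.ne_left
    (fun h' => hne (by simpa using h'.symm))
  refine ⟨k * h, N.mul_mem kN hN, ?_, fun h' => hkv (e1.trans h')⟩
  rw [mul_inv_rev]
  exact e2.symm.trans hh'

end Translation

theorem pow_apply_mem {E : Set V} {g : X ≃g X} (hE : ∀ v ∈ E, g v ∈ E) (k : ℕ) {v : V}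
    (hv : v ∈ E) : (g ^ k) v ∈ E := by
  induction k generalizing v with
  | zero => exact hv
  | succ k ih =>
    rw [pow_succ, RelIso.mul_apply]
    exact ih (hE v hv)

/-- The sets `gⁿ D` for a set `D` in a fundamental domain of `g` are pairwise disjoint. -/
theorem eq_of_mem_translates {E D : Set V} {g : X ≃g X} (hE : ∀ v ∈ E, g v ∈ E) (hDE : D ⊆ E)
    (hD : ∀ v ∈ D, g⁻¹ v ∉ E) {n m : ℕ} {v : V} (hn : (g ^ n)⁻¹ v ∈ D) (hm : (g ^ m)⁻¹ v ∈ D) :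
    n = m := by
  have key : ∀ {n m : ℕ}, (g ^ n)⁻¹ v ∈ D → (g ^ m)⁻¹ v ∈ D → ¬ n < m := by
    intro n m hn hm hlt
    obtain ⟨d, rfl⟩ := Nat.exists_eq_add_of_lt hlt
    refine hD _ hn ?_
    have := pow_apply_mem hE d (hDE hm)
    rw [← RelIso.mul_apply] at this
    rw [← RelIso.mul_apply]
    convert this using 2
    rw [pow_add, pow_add]
    group
  exact le_antisymm (not_lt.1 (key hm hn)) (not_lt.1 (key hn hm))

/-- An automorphism supported in a fundamental domain of `g` is a commutator with `g`. -/
theorem exists_commutator_of_supportedOn {E D : Set V} {g u : X ≃g X} (hE : ∀ v ∈ E, g v ∈ E)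
    (hDE : D ⊆ E) (hD : ∀ v ∈ D, g⁻¹ v ∉ E) (hu : SupportedOn u D) :
    ∃ w : X ≃g X, SupportedOn w E ∧ u = w * g * w⁻¹ * g⁻¹ := by
  obtain ⟨w, hw, hw'⟩ := exists_automorphism_of_disjoint
    (fun n : ℕ => {v | (g ^ n)⁻¹ v ∈ D}) (fun n => g ^ n * u * (g ^ n)⁻¹)
    (fun i j v hi hj => eq_of_mem_translates hE hDE hD hi hj)
    (fun n v hv => by simp only [RelIso.mul_apply]; rw [hu _ hv, RelIso.apply_inv_self])
  refine ⟨w, fun v hv => hw' v fun n hn => hv ?_, ?_⟩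
  · have := pow_apply_mem hE n (hDE hn)
    rwa [RelIso.apply_inv_self] at this
  -- Conjugation by `g` shifts the factors of the infinite product `w` by one, so only the factor
  -- `u` for `n = 0` is lost.
  have key : w = u * (g * w * g⁻¹) := by
    ext v
    simp only [RelIso.mul_apply]
    by_cases hv : ∃ n : ℕ, (g ^ n)⁻¹ v ∈ D
    · obtain ⟨n, hn⟩ := hv
      rw [hw n v hn]
      cases n with
      | zero =>
        rw [hw' (g⁻¹ v)]
        · simp
        · intro n hn'
          have : (g ^ (n + 1))⁻¹ v ∈ D := by
            rw [pow_succ', mul_inv_rev]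
            exact hn'
          exact absurd (eq_of_mem_translates hE hDE hD hn this) (by simp)
      | succ n =>
        have hn' : (g ^ n)⁻¹ (g⁻¹ v) ∈ D := by
          rw [pow_succ', mul_inv_rev] at hn
          exact hn
        rw [hw n _ hn', ← RelIso.mul_apply g, ← RelIso.mul_apply _ g⁻¹]
        have e : g * (g ^ n * u * (g ^ n)⁻¹) * g⁻¹ = g ^ (n + 1) * u * (g ^ (n + 1))⁻¹ := by
          rw [pow_succ']
          group
        rw [e, hu]
        intro hmem
        refine absurd (eq_of_mem_translates (n := 0) (m := n + 1) hE hDE hD (v :=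
          (g ^ (n + 1) * u * (g ^ (n + 1))⁻¹) v) (by simpa using hmem) ?_) (by simp)
        simp only [RelIso.mul_apply, RelIso.inv_apply_self]
        exact hu.map_mem_iff.2 hn
    · rw [hw' v (not_exists.1 hv), hw' (g⁻¹ v), RelIso.apply_inv_self, hu]
      · exact fun h => hv ⟨0, by simpa using h⟩
      · intro n hn
        refine hv ⟨n + 1, ?_⟩
        rw [pow_succ', mul_inv_rev]
        exact hn
  have : u = w * (g * w * g⁻¹)⁻¹ := eq_mul_inv_of_mul_eq key.symm
  rw [this]
  group

/-! ### Normalized subgroups contain the edge stabilizers of the block tree -/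

/-- `Γ` acts transitively on each block, by elements that preserve the block. -/
def BlockTransitive (Γ : Subgroup (X ≃g X)) : Prop :=
  ∀ x y, x ≠ y → X.Unseparated x y →
    ∃ γ ∈ Γ, γ x = y ∧ ∀ t, γ t ∈ X.blockSet x y ↔ t ∈ X.blockSet x y

/-- Every vertex is a cutvertex. -/
def AllCut (X : SimpleGraph V) : Prop :=
  ∀ x, ∃ u v, u ≠ x ∧ v ≠ x ∧ ¬ X.JoinedAvoiding x u v

theorem AllCut.exists_not_joinedAvoiding (h : X.AllCut) (x v : V) :
    ∃ c, c ≠ x ∧ ¬ X.JoinedAvoiding x v c := by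
  obtain ⟨a, b, ha, hb, hab⟩ := h x
  by_cases hva : X.JoinedAvoiding x v a
  · exact ⟨b, hb, fun h => hab (hva.symm.trans h)⟩
  · exact ⟨a, ha, hva⟩

/-- Every block has more than two vertices. -/
def ThickBlocks (X : SimpleGraph V) : Prop :=
  ∀ x y, x ≠ y → X.Unseparated x y → ∃ w ∈ X.blockSet x y, w ≠ x ∧ w ≠ y

/-- `g` fixes `x` and preserves the component of `X ∖ x` that contains `v`. -/
def FixesFlag (g : X ≃g X) (x v : V) : Prop :=
  g x = x ∧ X.JoinedAvoiding x v (g v)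

section Core

variable {Γ N : Subgroup (X ≃g X)}

/-- If the `N`-orbit of `x` missed the side of a neighbour `z`, conjugation by a block-preserving
element taking `x` to `z` would make the orbit of `z` miss the side of `x`. For `h ∈ N` moving `x`,
this places `x` between `h x` and `h z`, and then `h⁻¹ x` is on the side of `z` after all. -/
theorem exists_orbit_joinedAvoiding (hX : X.Connected)
    (hnorm : ∀ γ ∈ Γ, ∀ n ∈ N, γ * n * γ⁻¹ ∈ N)
    (hblock : BlockTransitive Γ) (hmove : ∀ x, ∃ h ∈ N, h x ≠ x)
    {x v : V} (hv : v ≠ x) : ∃ h ∈ N, X.JoinedAvoiding x (h x) v := by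
  by_contra! hno
  obtain ⟨z, hxz, hzv⟩ := exists_adj_joinedAvoiding hX hv
  have hns := hxz.unseparated
  have hx : ∀ h ∈ N, ¬ X.JoinedAvoiding x z (h x) := fun h hN hj =>
    hno h hN (hj.symm.trans hzv)
  obtain ⟨γ, hγ, hγx, hγB⟩ := hblock x z hxz.ne hns
  have hz : ∀ h ∈ N, ¬ X.JoinedAvoiding z x (h z) := by
    intro h hN hj
    have hγz : γ z ∈ X.blockSet x z := (hγB z).2 (right_mem_blockSet hns)
    have hne : γ z ≠ z := by
      intro h'
      exact hxz.ne (γ.injective (hγx.trans h'.symm))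
    have h1 : X.JoinedAvoiding z (γ z) x :=
      unseparated_of_mem_blockSet hxz.ne hγz (left_mem_blockSet hns) z hne.symm hxz.ne.symm
    have h2 := (h1.trans hj).map γ⁻¹
    refine hx (γ⁻¹ * h * γ) ?_ ?_
    · simpa using hnorm γ⁻¹ (Γ.inv_mem hγ) h hN
    · have e : γ⁻¹ z = x := by rw [← hγx, RelIso.inv_apply_self]
      simpa [RelIso.mul_apply, hγx, e] using h2
  obtain ⟨h, hN, hne⟩ := hmove x
  have h1 : X.JoinedAvoiding x z (h z) :=
    (hX.joinedAvoiding_or hxz.ne (h z)).resolve_left (hz h hN)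
  have h2 : ¬ X.JoinedAvoiding x (h x) (h z) := fun h' => hx h hN (h1.trans h'.symm)
  have h3 : X.JoinedAvoiding (h x) x (h z) :=
    (hX.joinedAvoiding_or hne (h z)).resolve_left h2
  refine hx h⁻¹ (N.inv_mem hN) ?_
  simpa using h3.symm.map h⁻¹

/-- The side of `g⁻¹ x` that contains `x` is mapped into itself by `g`. The branch at `z` lies in it
but not in its image, so it is contained in a fundamental domain of `g` and `u` is a commutator with
`g`. -/
theorem mem_of_supportedOn_of_translation (hX : X.Connected)
    (hnorm : ∀ γ ∈ Γ, ∀ n ∈ N, γ * n * γ⁻¹ ∈ N) (hcut : X.AllCut)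
    (hΓ : ∀ (g : X ≃g X) x v, FixesFlag g x v → g ∈ Γ)
    {x z : V} {g u : X ≃g X} (hg : g ∈ N)
    (hns : X.Unseparated x z) (hz : X.JoinedAvoiding x (g⁻¹ x) z)
    (hgz : ¬ X.JoinedAvoiding x (g x) z) (hgate : X.JoinedAvoiding z x (g⁻¹ x))
    (hu : SupportedOn u {v | ¬ X.JoinedAvoiding z x v}) : u ∈ N := by
  set p := g⁻¹ x with hp
  have hgp : g p = x := by simp [hp]
  have hpx : p ≠ x := hz.ne_left
  have hpz : p ≠ z := hgate.ne_right
  have hmapE : ∀ v, X.JoinedAvoiding x (g x) v → X.JoinedAvoiding p x v := by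
    intro v hv
    refine (hX.joinedAvoiding_or hpx v).resolve_left fun h => hgz ?_
    exact hv.trans (h.symm.trans hz)
  have hE : ∀ v ∈ {v | X.JoinedAvoiding p x v}, g v ∈ {v | X.JoinedAvoiding p x v} := by
    intro v hv
    refine hmapE _ ?_
    have := JoinedAvoiding.map g hv
    rwa [hgp] at this
  have hDE : {v | ¬ X.JoinedAvoiding z x v} ⊆ {v | X.JoinedAvoiding p x v} := by
    intro v hv
    have h1 : X.JoinedAvoiding p z v :=
      (hX.joinedAvoiding_or hpz v).resolve_left fun h => hv (hgate.trans h)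
    exact (hns p hpx hpz).trans h1
  have hD : ∀ v ∈ {v | ¬ X.JoinedAvoiding z x v}, g⁻¹ v ∉ {v | X.JoinedAvoiding p x v} := by
    intro v hv h
    have h1 := JoinedAvoiding.map g h
    rw [hgp, RelIso.apply_inv_self] at h1
    have h2 : X.JoinedAvoiding x z v :=
      (hX.joinedAvoiding_or hz.ne_right.symm v).resolve_left hv
    exact hgz (h1.trans h2.symm)
  obtain ⟨w, hw, rfl⟩ := exists_commutator_of_supportedOn hE hDE hD hu
  refine N.mul_mem (hnorm w ?_ g hg) (N.inv_mem hg)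
  -- The other factor `w` is in `Γ`, as it fixes `p` and every vertex on the sides of `p` away from
  -- `x`.
  obtain ⟨c, hc, hxc⟩ := hcut.exists_not_joinedAvoiding p x
  refine hΓ w p c ⟨hw p (by simp), ?_⟩
  rw [hw c hxc]
  exact .refl hc

/-- If the axis enters the block at `z` itself, the branch at `z` is not in a fundamental domain. A
third vertex `w` of the block then has a suitable branch, and `Γ` conjugates the one to the other.
-/
theorem mem_of_supportedOn (hX : X.Connected)
    (hnorm : ∀ γ ∈ Γ, ∀ n ∈ N, γ * n * γ⁻¹ ∈ N) (hcut : X.AllCut)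
    (hΓ : ∀ (g : X ≃g X) x v, FixesFlag g x v → g ∈ Γ) (hthick : X.ThickBlocks)
    (hblock : BlockTransitive Γ) (hmove : ∀ x, ∃ h ∈ N, h x ≠ x)
    {x z : V} {u : X ≃g X} (hxz : x ≠ z) (hns : X.Unseparated x z)
    (hu : SupportedOn u {v | ¬ X.JoinedAvoiding z x v}) : u ∈ N := by
  obtain ⟨g, hg, hgz, hgz'⟩ := exists_translation hX (hcut.exists_not_joinedAvoiding x)
    (fun v hv => exists_orbit_joinedAvoiding hX hnorm hblock hmove hv) hxz.symm
  by_cases hgate : X.JoinedAvoiding z x (g⁻¹ x)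
  · exact mem_of_supportedOn_of_translation hX hnorm hcut hΓ hg hns hgz hgz' hgate hu
  obtain ⟨w, hw, hwx, hwz⟩ := hthick x z hxz hns
  have hzxw : X.JoinedAvoiding z x w := hw.1 z hxz.symm hwz.symm
  have hzw : X.JoinedAvoiding w z (g⁻¹ x) :=
    (hX.joinedAvoiding_or hwz.symm _).resolve_right fun h => hgate (hzxw.trans h)
  have hxw : X.JoinedAvoiding x z w := hw.2 x hxz hwx.symm
  have hzB : z ∈ X.blockSet w z := ⟨hw.2.symm, .refl z⟩
  have hxB : x ∈ X.blockSet w z := ⟨hw.1.symm, hns.symm⟩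
  obtain ⟨γ, hγ, hγw, hγB⟩ := hblock w z hwz hw.2.symm
  have hγx : γ⁻¹ x ∈ X.blockSet w z := by rwa [← hγB, RelIso.apply_inv_self]
  have hγxw : γ⁻¹ x ≠ w := by
    intro h
    rw [← hγw, ← h, RelIso.apply_inv_self] at hxz
    exact hxz rfl
  have hj : X.JoinedAvoiding w (γ⁻¹ x) x :=
    unseparated_of_mem_blockSet hwz hγx hxB w hγxw.symm hwx
  have key : γ⁻¹ * u * γ ∈ N := by
    refine mem_of_supportedOn_of_translation hX hnorm hcut hΓ hg hw.1 (hgz.trans hxw)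
      (fun h => hgz' (h.trans hxw.symm)) ((hns w hwx hwz).trans hzw) ?_
    intro v hv
    have hv' : X.JoinedAvoiding z x (γ v) := by
      have h := (hj.trans (not_not.1 hv)).map γ
      rwa [hγw, RelIso.apply_inv_self] at h
    simp only [RelIso.mul_apply]
    rw [hu _ (not_not.2 hv'), RelIso.inv_apply_self]
  have := hnorm γ hγ _ key
  simpa [mul_assoc] using this

/-- A nontrivial subgroup normalized by `Γ` contains all stabilizers of edges of the block tree. -/
theorem mem_of_fixesFlag (hX : X.Connected)
    (hnorm : ∀ γ ∈ Γ, ∀ n ∈ N, γ * n * γ⁻¹ ∈ N) (hcut : X.AllCut)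
    (hΓ : ∀ (g : X ≃g X) x v, FixesFlag g x v → g ∈ Γ) (hthick : X.ThickBlocks)
    (hblock : BlockTransitive Γ) (hmove : ∀ x, ∃ h ∈ N, h x ≠ x)
    {x v : V} {g : X ≃g X} (hg : FixesFlag g x v) : g ∈ N := by
  obtain ⟨hgx, hgv⟩ := hg
  have hv := hgv.ne_left
  have hmem : ∀ w, X.JoinedAvoiding x v (g w) ↔ X.JoinedAvoiding x v w := by
    intro w
    rw [← joinedAvoiding_map_iff g (x := x) (u := v) (v := w), hgx]
    exact ⟨fun h => hgv.symm.trans h, fun h => hgv.trans h⟩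
  obtain ⟨a, ha, ha'⟩ := exists_automorphism_restrict g hgx {w | X.JoinedAvoiding x v w}
    (fun u w huw hu => JoinedAvoiding.trans hu huw) hmem
  obtain ⟨b, hb, hb'⟩ := exists_automorphism_restrict g hgx {w | ¬ X.JoinedAvoiding x v w}
    (fun u w huw hu h => hu (h.trans huw.symm)) fun w => not_congr (hmem w)
  have hab : g = a * b := by
    ext w
    rw [RelIso.mul_apply]
    by_cases hw : X.JoinedAvoiding x v w
    · rw [hb' w (by simpa using hw), ha w hw]
    · rw [hb w hw, ha' _ (mt (hmem w).1 hw)]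
  rw [hab]
  obtain ⟨z, hxz, hzv⟩ := exists_adj_joinedAvoiding hX hv
  refine N.mul_mem ?_ ?_
  -- The component of `v` is not itself known to be a branch as in `mem_of_supportedOn`, but it is
  -- contained in one: step from `x` to `z'` in another component and on to `y`; the branch at `z'`
  -- away from `y` contains it.
  · obtain ⟨v', hv', hvv'⟩ := hcut.exists_not_joinedAvoiding x v
    obtain ⟨z', hxz', hzv'⟩ := exists_adj_joinedAvoiding hX hv'
    obtain ⟨t, ht, hxt⟩ := hcut.exists_not_joinedAvoiding z' x
    obtain ⟨y, hzy, hyt⟩ := exists_adj_joinedAvoiding hX ht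
    refine mem_of_supportedOn hX hnorm hcut hΓ hthick hblock hmove hzy.ne.symm
      hzy.symm.unseparated fun w hw => ha' w fun (hw' : X.JoinedAvoiding x v w) => hw fun h => ?_
    have h1 : X.JoinedAvoiding z' x w :=
      (hX.joinedAvoiding_or hxz'.ne w).resolve_right fun h' =>
        hvv' (hw'.trans (h'.symm.trans hzv'))
    exact hxt (h1.trans (h.symm.trans hyt))
  · refine mem_of_supportedOn hX hnorm hcut hΓ hthick hblock hmove hxz.ne.symm
      hxz.symm.unseparated fun w hw => hb' w fun hw' => hw fun h => hw' (hzv.symm.trans h)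

end Core

/-! ### Transitivity, thick blocks and block transitivity from primitivity -/

section Primitivity

theorem IsPrimitive.exists_mem_apply_eq (hprim : X.IsPrimitive) {N : Subgroup (X ≃g X)}
    (hN : N.Normal) (hne : N ≠ ⊥) (x y : V) : ∃ h ∈ N, h x = y := by
  let s : Setoid V :=
    { r := fun u v => ∃ h ∈ N, h u = v
      iseqv :=
        { refl := fun u => ⟨1, N.one_mem, rfl⟩
          symm := by
            rintro u _ ⟨h, hh, rfl⟩
            exact ⟨h⁻¹, N.inv_mem hh, by simp⟩
          trans := by
            rintro u _ _ ⟨h, hh, rfl⟩ ⟨k, hk, rfl⟩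
            exact ⟨k * h, N.mul_mem hk hh, rfl⟩ } }
  rcases hprim s (by
    rintro g u _ ⟨h, hh, rfl⟩
    exact ⟨g * h * g⁻¹, hN.conj_mem h hh g, by simp [RelIso.mul_apply]⟩) with hs | hs
  · refine absurd ((Subgroup.eq_bot_iff_forall N).2 fun h hh => ?_) hne
    ext v
    have : s v (h v) := ⟨h, hh, rfl⟩
    rw [hs] at this
    exact Eq.symm this
  · have : s x y := by
      rw [hs]
      trivial
    exact this


/-- Under a trivial group the partition into `{x}` and its complement is invariant, and the
complement of a cutvertex has two elements. -/
theorem IsPrimitive.top_ne_bot (hprim : X.IsPrimitive) (hX : X.Connected) (hcut : X.AllCut) :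
    (⊤ : Subgroup (X ≃g X)) ≠ ⊥ := by
  intro h
  obtain ⟨x⟩ := hX.nonempty
  obtain ⟨u, v, hu, hv, huv⟩ := hcut x
  have hg : ∀ g : X ≃g X, g = 1 := fun g =>
    Subgroup.mem_bot.1 (h ▸ Subgroup.mem_top g)
  rcases hprim (Setoid.ker fun w => w = x) (fun g a b hab => by rwa [hg g]) with hs | hs
  · have : Setoid.ker (fun w => w = x) u v := by simp [Setoid.ker_def, hu, hv]
    rw [hs] at this
    have huv' : u = v := this
    exact huv (huv' ▸ .refl hu)
  · have : Setoid.ker (fun w => w = x) x u := by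
      rw [hs]
      trivial
    simp [Setoid.ker_def, hu] at this

theorem IsPrimitive.exists_apply_eq (hprim : X.IsPrimitive) (hX : X.Connected) (hcut : X.AllCut)
    (x y : V) : ∃ g : X ≃g X, g x = y := by
  obtain ⟨g, -, hg⟩ := hprim.exists_mem_apply_eq (Subgroup.normal_of_characteristic ⊤)
    (hprim.top_ne_bot hX hcut) x y
  exact ⟨g, hg⟩

/-- A connected primitive graph in which every vertex is a cutvertex is not bipartite. -/
theorem IsPrimitive.isEmpty_coloring (hprim : X.IsPrimitive) (hX : X.Connected)
    (hcut : X.AllCut) : IsEmpty (X.Coloring Bool) := by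
  refine ⟨fun c => ?_⟩
  obtain ⟨x⟩ := hX.nonempty
  obtain ⟨u, v, hu, hv, huv⟩ := hcut x
  obtain ⟨y, hxy, hyu⟩ := exists_adj_joinedAvoiding hX hu
  obtain ⟨z, hxz, hzv⟩ := exists_adj_joinedAvoiding hX hv
  -- Walks of even length relate two neighbours of `x` but, in a bipartite graph, not `x` and its
  -- neighbour.
  let s : Setoid V :=
    { r := fun u v => ∃ p : X.Walk u v, Even p.length
      iseqv :=
        { refl := fun u => ⟨Walk.nil, by simp⟩
          symm := by
            rintro u v ⟨p, hp⟩
            exact ⟨p.reverse, by simpa using hp⟩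
          trans := by
            rintro u v w ⟨p, hp⟩ ⟨q, hq⟩
            exact ⟨p.append q, by simpa using hp.add hq⟩ } }
  rcases hprim s (by
    rintro g u v ⟨p, hp⟩
    exact ⟨p.map g.toHom, by simpa using hp⟩) with hs | hs
  · have : s y z := ⟨Walk.cons hxy.symm (Walk.cons hxz Walk.nil), by simp⟩
    rw [hs] at this
    have hyz : y = z := this
    exact huv (hyu.symm.trans (hyz ▸ hzv))
  · have : s x y := by
      rw [hs]
      trivial
    obtain ⟨p, hp⟩ := this
    rw [c.even_length_iff_congr p] at hp
    exact c.valid hxy (Bool.eq_iff_iff.2 hp)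

/-- Lying together in a block with a third vertex is a relation of the kind tested inside blocks. If
it is trivial, `X` has no cycle, since a cycle lies in one block; but then `X` is bipartite. -/
theorem IsPrimitive.thickBlocks (hprim : X.IsPrimitive) (hX : X.Connected) (hcut : X.AllCut) :
    X.ThickBlocks := by
  refine (hprim.eq_or_forall_unseparated hX
    (fun u v => u = v ∨ X.Unseparated u v ∧ ∃ w ∈ X.blockSet u v, w ≠ u ∧ w ≠ v)
    (fun u => .inl rfl) ?_ ?_ ?_ ?_).elim (fun h => ?_) (fun h => ?_)
  · rintro u v (h | ⟨h, w, hw, hwu, hwv⟩)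
    · exact .inl h.symm
    · exact .inr ⟨h.symm, w, blockSet_comm u v ▸ hw, hwv, hwu⟩
  · intro u v w huv hvw huw
    rcases huv with rfl | ⟨huv, h⟩
    · exact hvw
    rcases hvw with rfl | ⟨hvw, h'⟩
    · exact .inr ⟨huv, h⟩
    by_cases huw' : u = w
    · exact .inl huw'
    by_cases huv' : v = u
    · subst huv'
      exact .inr ⟨hvw, h'⟩
    by_cases hvw' : v = w
    · subst hvw'
      exact .inr ⟨huv, h⟩
    exact .inr ⟨huw, v, ⟨huv, hvw.symm⟩, huv', hvw'⟩
  · rintro u v (rfl | h)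
    · exact .refl _
    · exact h.1
  · rintro g u v (rfl | ⟨h, w, hw, hwu, hwv⟩)
    · exact .inl rfl
    · exact .inr ⟨h.map g, g w, (map_mem_blockSet_iff g).2 hw, g.injective.ne hwu,
        g.injective.ne hwv⟩
  · have hac : X.IsAcyclic := by
      intro v c hc
      cases c with
      | nil => simp at hc
      | @cons _ w _ hadj p =>
        obtain ⟨hp, he⟩ := (Walk.cons_isCycle_iff p hadj).1 hc
        cases p with
        | nil => exact hadj.ne rfl
        | @cons _ t _ hwt q =>
          have htv : t ≠ v := by
            rintro rfl
            exact he (by simp [Sym2.eq_swap])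
          exact hadj.ne (h v w (.inr ⟨hadj.unseparated, t, blockSet_comm w v ▸
            hadj.symm.unseparated.mem_blockSet_of_mem_support _ hp (by simp), htv, hwt.ne.symm⟩))
    obtain ⟨c⟩ := hac.colorable_two
    exact (hprim.isEmpty_coloring hX hcut).elim
      (recolorOfEquiv X finTwoEquiv c)
  · intro x y hxy hns
    exact ((h x y hns).resolve_left hxy).2

/-- The orbits of the stabilizers of blocks form a relation tested inside blocks. If it is trivial,
these stabilizers fix their blocks pointwise, and a second relation gives a contradiction. -/
theorem IsPrimitive.blockTransitive (hprim : X.IsPrimitive) (hX : X.Connected) (hcut : X.AllCut) :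
    BlockTransitive (⊤ : Subgroup (X ≃g X)) := by
  have hthick := hprim.thickBlocks hX hcut
  have hmap : ∀ (g : X ≃g X) u v t, t ∈ X.blockSet (g u) (g v) ↔ g⁻¹ t ∈ X.blockSet u v := by
    intro g u v t
    rw [← map_mem_blockSet_iff g (w := g⁻¹ t), RelIso.apply_inv_self]
  refine (hprim.eq_or_forall_unseparated hX (fun u v => u = v ∨ X.Unseparated u v ∧
      ∃ g : X ≃g X, g u = v ∧ ∀ t, g t ∈ X.blockSet u v ↔ t ∈ X.blockSet u v)
    (fun u => .inl rfl) ?_ ?_ ?_ ?_).elim (fun h => ?_) (fun h => ?_)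
  · rintro u v (h | ⟨h, g, rfl, hg⟩)
    · exact .inl h.symm
    · refine .inr ⟨h.symm, g⁻¹, by simp, fun t => ?_⟩
      rw [blockSet_comm, ← hg, RelIso.apply_inv_self]
  · rintro u v w (rfl | ⟨huv, g, hgu, hg⟩) hvw huw
    · exact hvw
    rcases hvw with rfl | ⟨hvw, k, hkv, hk⟩
    · exact .inr ⟨huv, g, hgu, hg⟩
    by_cases huw' : u = w
    · exact .inl huw'
    by_cases huv' : u = v
    · subst huv'
      exact .inr ⟨hvw, k, hkv, hk⟩
    by_cases hvw' : v = w
    · subst hvw'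
      exact .inr ⟨huv, g, hgu, hg⟩
    have e1 : X.blockSet u w = X.blockSet u v := blockSet_eq_of_mem huv' huw'
      (left_mem_blockSet huv) ⟨huw, hvw⟩
    have e2 : X.blockSet u w = X.blockSet v w := blockSet_eq_of_mem hvw' huw'
      ⟨huv.symm, huw.symm⟩ (right_mem_blockSet hvw)
    refine .inr ⟨huw, k * g, by rw [RelIso.mul_apply, hgu, hkv], fun t => ?_⟩
    rw [RelIso.mul_apply, e2, hk, ← e2, e1, hg]
  · rintro u v (rfl | h)
    · exact .refl _
    · exact h.1
  · rintro k u v (rfl | ⟨h, g, hgu, hg⟩)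
    · exact .inl rfl
    · refine .inr ⟨h.map k, k * g * k⁻¹, by simp [RelIso.mul_apply, hgu], fun t => ?_⟩
      rw [RelIso.mul_apply, RelIso.mul_apply, map_mem_blockSet_iff, hg, hmap]
  · exfalso
    obtain ⟨x⟩ := hX.nonempty
    obtain ⟨a, -, ha, -⟩ := hcut x
    obtain ⟨u, hxu, -⟩ := exists_adj_joinedAvoiding hX ha
    have hns := hxu.unseparated
    obtain ⟨w, hw, hwx, hwu⟩ := hthick x u hxu.ne hns
    have hfix : ∀ g : X ≃g X, (∀ t, g t ∈ X.blockSet x u ↔ t ∈ X.blockSet x u) →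
        ∀ t ∈ X.blockSet x u, g t = t := by
      intro g hg t ht
      by_contra hne
      have hgt := (hg t).2 ht
      have e := blockSet_eq_of_mem hxu.ne (Ne.symm hne) ht hgt
      exact hne (h t (g t) (.inr ⟨unseparated_of_mem_blockSet hxu.ne ht hgt, g, rfl,
        by rwa [e]⟩)).symm
    have hfix2 : ∀ g : X ≃g X, ∀ a b, a ≠ b → a ∈ X.blockSet x u → b ∈ X.blockSet x u →
        g a ∈ X.blockSet x u → g b ∈ X.blockSet x u → ∀ t ∈ X.blockSet x u, g t = t :=
      fun g a b hab ha hb hga hgb => hfix g fun t =>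
        map_mem_blockSet_iff_of_mem g hxu.ne hab ha hb hga hgb
    have hxB := left_mem_blockSet hns
    have huB := right_mem_blockSet hns
    -- Two translates of the pair `x`, `u` within one block coincide, so transitivity is vacuous for
    -- three distinct vertices. The relation is not full, because the third vertex `w` is not
    -- related to `x`.
    refine (hprim.eq_or_forall_unseparated hX (fun s t => s = t ∨
        ∃ g : X ≃g X, (s = g x ∧ t = g u) ∨ (s = g u ∧ t = g x))
      (fun s => .inl rfl) ?_ ?_ ?_ ?_).elim (fun h => ?_) (fun h => ?_)
    · rintro s t (rfl | ⟨g, h⟩)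
      · exact .inl rfl
      · exact .inr ⟨g, by tauto⟩
    · intro s t q hst htq hsq
      by_cases hst' : s = t
      · exact hst' ▸ htq
      by_cases htq' : t = q
      · exact htq' ▸ hst
      obtain ⟨g, hg⟩ := hst.resolve_left hst'
      obtain ⟨k, hk⟩ := htq.resolve_left htq'
      by_cases hsq' : s = q
      · exact .inl hsq'
      exfalso
      have hns' : X.Unseparated (g x) (g u) := hns.map g
      have hne' : g x ≠ g u := g.injective.ne hxu.ne
      have hsB : s ∈ X.blockSet (g x) (g u) ∧ t ∈ X.blockSet (g x) (g u) := by
        rcases hg with ⟨rfl, rfl⟩ | ⟨rfl, rfl⟩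
        · exact ⟨left_mem_blockSet hns', right_mem_blockSet hns'⟩
        · exact ⟨right_mem_blockSet hns', left_mem_blockSet hns'⟩
      have htq'' : X.Unseparated t q := by
        rcases hk with ⟨rfl, rfl⟩ | ⟨rfl, rfl⟩
        · exact hns.map k
        · exact hns.symm.map k
      have hqB : q ∈ X.blockSet (g x) (g u) := by
        rw [← blockSet_eq_of_mem hne' hst' hsB.1 hsB.2]
        exact ⟨hsq, htq''⟩
      have hkB : k x ∈ X.blockSet (g x) (g u) ∧ k u ∈ X.blockSet (g x) (g u) := by
        rcases hk with ⟨rfl, rfl⟩ | ⟨rfl, rfl⟩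
        · exact ⟨hsB.2, hqB⟩
        · exact ⟨hqB, hsB.2⟩
      rw [hmap, hmap] at hkB
      have hf := hfix2 (g⁻¹ * k) x u hxu.ne hxB huB hkB.1 hkB.2
      have e : ∀ t ∈ X.blockSet x u, k t = g t := fun t ht => by
        conv_rhs => rw [← hf t ht]
        simp [RelIso.mul_apply]
      rw [e x hxB, e u huB] at hk
      rcases hg with ⟨rfl, rfl⟩ | ⟨rfl, rfl⟩ <;> rcases hk with ⟨h1, rfl⟩ | ⟨h1, rfl⟩
      · exact hst' h1.symm
      · exact hsq' rfl
      · exact hsq' rfl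
      · exact hst' h1.symm
    · rintro s t (rfl | ⟨g, ⟨rfl, rfl⟩ | ⟨rfl, rfl⟩⟩)
      · exact .refl _
      · exact hns.map g
      · exact hns.symm.map g
    · rintro k s t (rfl | ⟨g, ⟨rfl, rfl⟩ | ⟨rfl, rfl⟩⟩)
      · exact .inl rfl
      · exact .inr ⟨k * g, .inl ⟨rfl, rfl⟩⟩
      · exact .inr ⟨k * g, .inr ⟨rfl, rfl⟩⟩
    · exact hxu.ne (h x u (.inr ⟨1, .inl ⟨rfl, rfl⟩⟩))
    · obtain ⟨g, hg⟩ := (h x w hw.1).resolve_left (Ne.symm hwx)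
      have hgB : g x ∈ X.blockSet x u ∧ g u ∈ X.blockSet x u := by
        rcases hg with ⟨h1, h2⟩ | ⟨h1, h2⟩
        · exact ⟨h1 ▸ hxB, h2 ▸ hw⟩
        · exact ⟨h2 ▸ hw, h1 ▸ hxB⟩
      have hf := hfix2 g x u hxu.ne hxB huB hgB.1 hgB.2
      rw [hf x hxB, hf u huB] at hg
      rcases hg with ⟨-, h2⟩ | ⟨-, h2⟩
      · exact hwu h2
      · exact hwx h2
  · intro x y hxy hns
    obtain ⟨-, g, hg⟩ := (h x y hns).resolve_left hxy
    exact ⟨g, Subgroup.mem_top g, hg⟩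

end Primitivity

/-! ### The blocks at a vertex correspond to the components left by its deletion -/

section Blocks

variable {x y u v w : V}

theorem Walk.reachable_lift {W : Type*} (H : SimpleGraph W) (P : V → Prop) (ι : ∀ w, P w → W)
    (hι : ∀ u v hu hv, X.Adj u v → H.Adj (ι u hu) (ι v hv)) (p : X.Walk u v)
    (hp : ∀ w ∈ p.support, P w) :
    H.Reachable (ι u (hp u p.start_mem_support)) (ι v (hp v p.end_mem_support)) := by
  induction p with
  | nil => exact .refl _
  | @cons a b c h q ih =>
    have hq : ∀ w ∈ q.support, P w := fun w hw => hp w (by simp [hw])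
    exact (hι a b _ (hq b q.start_mem_support) h).reachable.trans (ih hq)

theorem Reachable.joinedAvoiding_map {W : Type*} {H : SimpleGraph W} (f : H →g X) {a b : W}
    {z : V} (hf : ∀ c, f c ≠ z) (h : H.Reachable a b) : X.JoinedAvoiding z (f a) (f b) := by
  obtain ⟨p⟩ := h
  induction p with
  | nil => exact .refl (hf _)
  | cons h _ ih => exact (JoinedAvoiding.of_adj (f.map_adj h) (hf _) (hf _)).trans ih

theorem Subgraph.unseparated (H : X.Subgraph) (hH : H.Connected)
    (hH' : ¬ H.coe.HasConnectivityOne) (hu : u ∈ H.verts) (hv : v ∈ H.verts) :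
    X.Unseparated u v := by
  intro z hzu hzv
  by_cases hz : z ∈ H.verts
  · have hcut : (H.coe.induce ({⟨z, hz⟩}ᶜ : Set H.verts)).Preconnected := by
      by_contra h
      exact hH' ⟨hH.coe, _, h⟩
    refine (hcut ⟨⟨u, hu⟩, by simpa using hzu.symm⟩
      ⟨⟨v, hv⟩, by simpa using hzv.symm⟩).joinedAvoiding_map
      (H.hom.comp (Embedding.induce ({⟨z, hz⟩}ᶜ : Set H.verts)).toHom)
        fun c hc => c.2 (Subtype.ext hc)
  · refine (hH.coe.preconnected ⟨u, hu⟩ ⟨v, hv⟩).joinedAvoiding_map H.hom fun c hc => hz ?_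
    exact hc ▸ c.2

/-- Paths between vertices of the set stay inside it, which gives connectedness, also after deletion
of a vertex. Maximality holds because a larger such subgraph has only vertices unseparated from `x`
and `y`. -/
theorem isBlock_induce_blockSet (hX : X.Connected) (hxy : x ≠ y) (h : X.Unseparated x y) :
    X.IsBlock ((⊤ : X.Subgraph).induce (X.blockSet x y)) := by
  classical
  have hstay : ∀ {a b}, a ∈ X.blockSet x y → b ∈ X.blockSet x y → ∀ p : X.Walk a b, p.IsPath →
      ∀ c ∈ p.support, c ∈ X.blockSet x y := by
    intro a b ha hb p hp c hc
    by_cases hab : a = b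
    · subst hab
      rw [(Walk.isPath_iff_nil.1 hp).eq_nil] at hc
      simp only [Walk.support_nil, List.mem_singleton] at hc
      exact hc ▸ ha
    · rw [← blockSet_eq_of_mem hxy hab ha hb]
      exact (unseparated_of_mem_blockSet hxy ha hb).mem_blockSet_of_mem_support p hp hc
  refine ⟨⟨⟨?_⟩, ?_⟩, ?_⟩
  · have : Nonempty ((⊤ : X.Subgraph).induce (X.blockSet x y)).verts :=
      ⟨⟨x, left_mem_blockSet h⟩⟩
    refine ⟨?_⟩
    rintro ⟨a, ha⟩ ⟨b, hb⟩
    obtain ⟨p⟩ := hX.preconnected a b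
    refine Walk.reachable_lift (((⊤ : X.Subgraph).induce (X.blockSet x y)).coe)
      (fun w => w ∈ X.blockSet x y) (fun w hw => ⟨w, hw⟩) ?_ p.toPath.1
      (hstay ha hb _ p.toPath.2)
    intro u v hu hv huv
    simp [hu, hv, huv]
  · rintro ⟨-, ⟨z, hz⟩, hcut⟩
    refine hcut ?_
    rintro ⟨⟨a, ha⟩, haz⟩ ⟨⟨b, hb⟩, hbz⟩
    have haz' : z ≠ a := by
      rintro rfl
      exact haz rfl
    have hbz' : z ≠ b := by
      rintro rfl
      exact hbz rfl
    obtain ⟨p, hp⟩ := unseparated_of_mem_blockSet hxy ha hb z haz' hbz'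
    refine Walk.reachable_lift
      ((((⊤ : X.Subgraph).induce (X.blockSet x y)).coe).induce ({⟨z, hz⟩}ᶜ))
      (fun w => w ∈ X.blockSet x y ∧ w ≠ z)
      (fun w hw => ⟨⟨w, hw.1⟩, fun h => hw.2 (congrArg Subtype.val h)⟩) ?_ p.toPath.1
      (fun c hc => ⟨hstay ha hb _ p.toPath.2 c hc, ?_⟩)
    · intro u v hu hv huv
      simp [hu.1, hv.1, huv]
    · rintro rfl
      exact hp (p.support_toPath_subset_support hc)
  · rintro H ⟨hH, hH'⟩ hle
    have hxH : x ∈ H.verts := hle.1 (left_mem_blockSet h)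
    have hyH : y ∈ H.verts := hle.1 (right_mem_blockSet h)
    have hsub : H.verts ⊆ X.blockSet x y := fun w hw =>
      ⟨H.unseparated hH hH' hxH hw, H.unseparated hH hH' hyH hw⟩
    refine ⟨hsub, fun a b hab => ?_⟩
    simp [hsub hab.fst_mem, hsub hab.snd_mem, hab.adj_sub]

theorem IsBlock.le_induce_blockSet {B : X.Subgraph} (hB : X.IsBlock B)
    (hx : x ∈ B.verts) (hy : y ∈ B.verts) : B ≤ (⊤ : X.Subgraph).induce (X.blockSet x y) := by
  have hsub : B.verts ⊆ X.blockSet x y := fun w hw =>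
    ⟨B.unseparated hB.prop.1 hB.prop.2 hx hw, B.unseparated hB.prop.1 hB.prop.2 hy hw⟩
  refine ⟨hsub, fun a b hab => ?_⟩
  simp [hsub hab.fst_mem, hsub hab.snd_mem, hab.adj_sub]

theorem IsBlock.eq_induce_blockSet (hX : X.Connected) {B : X.Subgraph} (hB : X.IsBlock B)
    (hxy : x ≠ y) (hx : x ∈ B.verts) (hy : y ∈ B.verts) :
    B = (⊤ : X.Subgraph).induce (X.blockSet x y) :=
  Maximal.eq_of_le hB (isBlock_induce_blockSet hX hxy
    (B.unseparated hB.prop.1 hB.prop.2 hx hy)).prop (hB.le_induce_blockSet hx hy)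

/-- The block at `x` that reaches into the component of `X ∖ x` containing `v`. -/
theorem exists_blocksAt (hX : X.Connected) (hv : v ≠ x) :
    ∃ B ∈ X.blocksAt x, ∃ c ∈ B.verts, X.JoinedAvoiding x c v := by
  obtain ⟨z, hxz, hzv⟩ := exists_adj_joinedAvoiding hX hv
  exact ⟨_, ⟨isBlock_induce_blockSet hX hxz.ne hxz.unseparated,
    left_mem_blockSet hxz.unseparated⟩, z, right_mem_blockSet hxz.unseparated, hzv⟩

/-- A subgraph consisting of `x` alone lies in `B'` and is not maximal. -/
theorem exists_ne_of_mem_blocksAt {B B' : X.Subgraph} (hB : B ∈ X.blocksAt x)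
    (hB' : B' ∈ X.blocksAt x) (hne : B ≠ B') : ∃ c ∈ B.verts, c ≠ x := by
  by_contra! h
  have hsing : ∀ c ∈ B.verts, c = x := h
  refine hne (Maximal.eq_of_le hB.1 hB'.1.prop ⟨fun c hc => hsing c hc ▸ hB'.2, ?_⟩)
  intro a b hab
  exact absurd ((hsing a hab.fst_mem).trans (hsing b hab.snd_mem).symm) hab.ne

theorem blocksAt_eq_of_joinedAvoiding (hX : X.Connected) {B B' : X.Subgraph}
    (hB : B ∈ X.blocksAt x) (hB' : B' ∈ X.blocksAt x) (hu : u ∈ B.verts) (hv : v ∈ B'.verts)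
    (h : X.JoinedAvoiding x u v) : B = B' := by
  have hxu := B.unseparated hB.1.prop.1 hB.1.prop.2 hB.2 hu
  have hxv := B'.unseparated hB'.1.prop.1 hB'.1.prop.2 hB'.2 hv
  rw [hB.1.eq_induce_blockSet hX h.ne_left.symm hB.2 hu,
    hB'.1.eq_induce_blockSet hX h.ne_right.symm hB'.2 hv]
  congr 1
  exact blockSet_eq_of_mem h.ne_right.symm h.ne_left.symm (left_mem_blockSet hxv)
    ⟨hxu, (hxu.of_joinedAvoiding hxv h).symm⟩

theorem joinedAvoiding_of_mem_blocksAt {B : X.Subgraph} (hB : B ∈ X.blocksAt x)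
    (hu : u ∈ B.verts) (hv : v ∈ B.verts) (hux : u ≠ x) (hvx : v ≠ x) :
    X.JoinedAvoiding x u v :=
  B.unseparated hB.1.prop.1 hB.1.prop.2 hu hv x hux.symm hvx.symm

theorem allCut_of_one_lt_encard (hX : X.Connected) (h : ∀ x, 1 < (X.blocksAt x).encard) :
    X.AllCut := by
  intro x
  obtain ⟨B, B', hB, hB', hne⟩ := Set.one_lt_encard_iff.1 (h x)
  obtain ⟨c, hc, hcx⟩ := exists_ne_of_mem_blocksAt hB hB' hne
  obtain ⟨c', hc', hcx'⟩ := exists_ne_of_mem_blocksAt hB' hB hne.symm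
  exact ⟨c, c', hcx, hcx', fun h => hne (blocksAt_eq_of_joinedAvoiding hX hB hB' hc hc' h)⟩

theorem exists_third_of_two_lt_encard (hX : X.Connected) (h : 2 < (X.blocksAt x).encard)
    (hu : u ≠ x) (hv : v ≠ x) :
    ∃ c, c ≠ x ∧ ¬ X.JoinedAvoiding x u c ∧ ¬ X.JoinedAvoiding x v c := by
  obtain ⟨B, hB, b, hb, hbu⟩ := exists_blocksAt hX hu
  obtain ⟨C, hC, c, hc, hcv⟩ := exists_blocksAt hX hv
  have : ∃ D ∈ X.blocksAt x, D ∉ ({B, C} : Set X.Subgraph) := by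
    by_contra! hsub
    exact absurd (h.trans_le (Set.encard_le_encard (t := {B, C}) hsub))
      (not_lt.2 ((Set.encard_insert_le _ _).trans
        (by rw [Set.encard_singleton, one_add_one_eq_two])))
  obtain ⟨D, hD, hDBC⟩ := this
  simp only [Set.mem_insert_iff, Set.mem_singleton_iff, not_or] at hDBC
  obtain ⟨d, hd, hdx⟩ := exists_ne_of_mem_blocksAt hD hB hDBC.1
  exact ⟨d, hdx,
    fun h => hDBC.1 (blocksAt_eq_of_joinedAvoiding hX hB hD hb hd (hbu.trans h)).symm,
    fun h => hDBC.2 (blocksAt_eq_of_joinedAvoiding hX hC hD hc hd (hcv.trans h)).symm⟩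

theorem joinedAvoiding_or_of_encard_le_two (hX : X.Connected) (h : (X.blocksAt x).encard ≤ 2)
    (hu : u ≠ x) (hv : v ≠ x) (hw : w ≠ x) (huv : ¬ X.JoinedAvoiding x u v) :
    X.JoinedAvoiding x u w ∨ X.JoinedAvoiding x v w := by
  obtain ⟨B, hB, b, hb, hbu⟩ := exists_blocksAt hX hu
  obtain ⟨C, hC, c, hc, hcv⟩ := exists_blocksAt hX hv
  obtain ⟨D, hD, d, hd, hdw⟩ := exists_blocksAt hX hw
  have hBC : B ≠ C := by
    rintro rfl
    exact huv (hbu.symm.trans ((joinedAvoiding_of_mem_blocksAt hB hb hc hbu.ne_left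
      hcv.ne_left).trans hcv))
  by_contra! hne
  have hBD : B ≠ D := by
    rintro rfl
    exact hne.1 (hbu.symm.trans ((joinedAvoiding_of_mem_blocksAt hB hb hd hbu.ne_left
      hdw.ne_left).trans hdw))
  have hCD : C ≠ D := by
    rintro rfl
    exact hne.2 (hcv.symm.trans ((joinedAvoiding_of_mem_blocksAt hC hc hd hcv.ne_left
      hdw.ne_left).trans hdw))
  have hsub : ({B, C, D} : Set X.Subgraph) ⊆ X.blocksAt x := by
    rintro E (rfl | rfl | rfl) <;> assumption
  have h3 := (Set.encard_le_encard hsub).trans h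
  rw [Set.encard_eq_three.2 ⟨B, C, D, hBC, hBD, hCD, rfl⟩] at h3
  exact absurd h3 (by decide)

end Blocks

/-! ### At least three components at each vertex -/

/-- If each vertex deletion leaves at least three components, then `Aut X` is simple. -/
theorem isSimpleGroup_of_three_components (hprim : X.IsPrimitive) (hX : X.Connected)
    (hcut : X.AllCut) (hthree : ∀ x u v : V, u ≠ x → v ≠ x →
      ∃ c, c ≠ x ∧ ¬ X.JoinedAvoiding x u c ∧ ¬ X.JoinedAvoiding x v c) :
    IsSimpleGroup (X ≃g X) := by
  have hne := hprim.top_ne_bot hX hcut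
  have : Nontrivial (X ≃g X) := Subgroup.nontrivial_iff.1 ⟨⊤, ⊥, hne⟩
  refine ⟨fun N hN => or_iff_not_imp_left.2 fun hNbot => ?_⟩
  have htrans := hprim.exists_mem_apply_eq hN hNbot
  have hmove : ∀ x, ∃ h ∈ N, h x ≠ x := by
    intro x
    obtain ⟨u, -, hu, -⟩ := hcut x
    obtain ⟨h, hh, hx⟩ := htrans x u
    exact ⟨h, hh, hx ▸ hu⟩
  have hflag : ∀ (g : X ≃g X) x v, FixesFlag g x v → g ∈ N := fun g x v hg =>
    mem_of_fixesFlag hX (Γ := ⊤) (fun γ _ n hn => hN.conj_mem n hn γ) hcut (fun _ _ _ _ =>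
      Subgroup.mem_top _) (hprim.thickBlocks hX hcut) (hprim.blockTransitive hX hcut) hmove hg
  have hstab : ∀ (g : X ≃g X) x, g x = x → g ∈ N := by
    intro g x hgx
    obtain ⟨v, -, hv, -⟩ := hcut x
    by_cases hgv : X.JoinedAvoiding x v (g v)
    · exact hflag g x v ⟨hgx, hgv⟩
    have hgvx : g v ≠ x := fun h => hv (g.injective (h.trans hgx.symm))
    -- The swap `s` fixes a third component pointwise and `s⁻¹ * g` fixes `v`; so both fix flags.
    obtain ⟨c, hc, hvc, hgvc⟩ := hthree x v (g v) hv hgvx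
    obtain ⟨s, hsx, hs, hs'⟩ := exists_automorphism_swap g hgx hgv
    have hsN : s ∈ N := by
      refine hflag s x c ⟨hsx, ?_⟩
      rw [hs' c hvc hgvc]
      exact .refl hc
    have hsg : s⁻¹ * g ∈ N := by
      refine hflag _ x v ⟨?_, ?_⟩
      · rw [RelIso.mul_apply, hgx, ← s.injective.eq_iff, RelIso.apply_inv_self, hsx]
      · rw [RelIso.mul_apply, ← hs v (.refl hv), RelIso.inv_apply_self]
        exact .refl hv
    simpa using N.mul_mem hsN hsg
  refine (Subgroup.eq_top_iff' N).2 fun g => ?_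
  obtain ⟨x⟩ := hX.nonempty
  obtain ⟨h, hh, hx⟩ := htrans x (g x)
  have := N.mul_mem hh (hstab (h⁻¹ * g) x (by rw [RelIso.mul_apply, ← hx, RelIso.inv_apply_self]))
  simpa using this

/-! ### Two components at each vertex: colouring the blocks -/

/-- A vertex deletion leaves at most two components. -/
def TwoSided (X : SimpleGraph V) : Prop :=
  ∀ x u v w, u ≠ x → v ≠ x → w ≠ x → ¬ X.JoinedAvoiding x u v →
    X.JoinedAvoiding x u w ∨ X.JoinedAvoiding x v w

/-- A colouring of the blocks such that the blocks at a vertex have different colours. The block at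
`x` in the component of `X ∖ x` that contains `v` is represented by the pair of `x` and `v`. -/
structure IsFlagColoring (X : SimpleGraph V) (c : V → V → Prop) : Prop where
  congr : ∀ {x u v}, X.JoinedAvoiding x u v → (c x u ↔ c x v)
  comm : ∀ {x y}, x ≠ y → X.Unseparated x y → (c x y ↔ c y x)
  alternate : ∀ {x u v}, u ≠ x → v ≠ x → ¬ X.JoinedAvoiding x u v → (c x u ↔ ¬ c x v)

/-- The colour of a flag is the parity of the number of vertices that separate it from the base flag
of `o` and `o'`. Here `rep z x v` stands for the flag of `x` and `v` as seen from `z`, with `v`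
taking over when `z` is `x`. Changing sides at `x` toggles only whether `x` itself separates, as
just one of the two sides contains the base. -/
theorem exists_isFlagColoring (hX : X.Connected) (hcut : X.AllCut) (htwo : X.TwoSided) :
    ∃ c, X.IsFlagColoring c := by
  classical
  obtain ⟨o⟩ := hX.nonempty
  obtain ⟨o', -, ho, -⟩ := hcut o
  let rep : V → V → V → V := fun z x v => if z = x then v else x
  let S : V → V → Set V := fun x v => {z | ¬ X.JoinedAvoiding z (rep z o o') (rep z x v)}
  have rep_eq : ∀ x v, rep x x v = v := fun x v => if_pos rfl
  have rep_ne : ∀ z x v, z ≠ x → rep z x v = x := fun z x v h => if_neg h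
  have hfin : ∀ x v, (S x v).Finite := by
    intro x v
    obtain ⟨p⟩ := hX.preconnected o x
    refine (List.finite_toSet p.support).subset fun z hz => ?_
    by_contra hzp
    refine hz ?_
    have h1 : z ≠ o := by
      rintro rfl
      exact hzp p.start_mem_support
    have h2 : z ≠ x := by
      rintro rfl
      exact hzp p.end_mem_support
    rw [rep_ne _ _ _ h1, rep_ne _ _ _ h2]
    exact ⟨p, hzp⟩
  refine ⟨fun x v => Even (S x v).ncard, ?_, ?_, ?_⟩
  · intro x u v huv
    have : S x u = S x v := by
      ext z
      by_cases hz : z = x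
      · subst hz
        simp only [S, Set.mem_ofPred_eq, rep_eq]
        exact not_congr ⟨fun h => h.trans huv, fun h => h.trans huv.symm⟩
      · simp only [S, Set.mem_ofPred_eq, rep_ne _ _ _ hz]
    rw [this]
  · intro x y hxy hns
    have : S x y = S y x := by
      ext z
      simp only [S, Set.mem_ofPred_eq]
      by_cases hzx : z = x
      · subst hzx
        rw [rep_eq, rep_ne _ _ _ hxy]
      by_cases hzy : z = y
      · subst hzy
        rw [rep_eq, rep_ne _ _ _ hzx]
      rw [rep_ne _ _ _ hzx, rep_ne _ _ _ hzy]
      have := hns z hzx hzy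
      exact not_congr ⟨fun h => h.trans this, fun h => h.trans this.symm⟩
    rw [this]
  · intro x u v hu hv huv
    have hr : rep x o o' ≠ x := by
      by_cases h : x = o
      · subst h
        rwa [rep_eq]
      · rw [rep_ne _ _ _ h]
        exact Ne.symm h
    have hu' : x ∈ S x u ↔ ¬ X.JoinedAvoiding x (rep x o o') u := by
      simp only [S, Set.mem_ofPred_eq, rep_eq]
    have hv' : x ∈ S x v ↔ ¬ X.JoinedAvoiding x (rep x o o') v := by
      simp only [S, Set.mem_ofPred_eq, rep_eq]
    have hne : ∀ z, z ≠ x → (z ∈ S x u ↔ z ∈ S x v) := by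
      intro z hz
      simp only [S, Set.mem_ofPred_eq, rep_ne _ _ _ hz]
    have key : ∀ a b, x ∈ S x a → x ∉ S x b → (∀ z, z ≠ x → (z ∈ S x a ↔ z ∈ S x b)) →
        (Even (S x a).ncard ↔ ¬ Even (S x b).ncard) := by
      intro a b ha hb hab
      have : S x a = insert x (S x b) := by
        ext z
        by_cases hz : z = x
        · subst hz
          simp [ha]
        · simp [hz, hab z hz]
      rw [this, Set.ncard_insert_of_notMem hb (hfin x b), Nat.even_add_one]
    rcases htwo x u v _ hu hv hr huv with h | h
    · have h1 : x ∉ S x u := by simpa [hu'] using h.symm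
      have h2 : x ∈ S x v := hv'.2 fun h' => huv (h.trans h')
      have := key v u h2 h1 fun z hz => (hne z hz).symm
      tauto
    · have h1 : x ∉ S x v := by simpa [hv'] using h.symm
      have h2 : x ∈ S x u := hu'.2 fun h' => huv (h.trans h').symm
      exact key u v h2 h1 hne

/-- The automorphisms that preserve the colours of the blocks. -/
def colorStabilizer (X : SimpleGraph V) (c : V → V → Prop) : Subgroup (X ≃g X) where
  carrier := {g | ∀ x v, v ≠ x → (c (g x) (g v) ↔ c x v)}
  one_mem' := fun _ _ _ => Iff.rfl
  mul_mem' := fun {g h} hg hh x v hv => (hg _ _ (h.injective.ne hv)).trans (hh x v hv)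
  inv_mem' := fun {g} hg x v hv => by
    have := hg (g⁻¹ x) (g⁻¹ v) (g⁻¹.injective.ne hv)
    rw [RelIso.apply_inv_self, RelIso.apply_inv_self] at this
    exact this.symm

namespace IsFlagColoring

variable {c : V → V → Prop}

/-- Whether `g` keeps the colour is the same for both blocks at a vertex, as colours alternate, and
passes along edges, as adjacent vertices share a block. -/
theorem keeps_iff (hc : X.IsFlagColoring c) (hX : X.Connected) (g : X ≃g X) {x v y w : V}
    (hv : v ≠ x) (hw : w ≠ y) :
    (c (g x) (g v) ↔ c x v) ↔ (c (g y) (g w) ↔ c y w) := by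
  have hsame : ∀ {x u v}, u ≠ x → v ≠ x →
      ((c (g x) (g u) ↔ c x u) ↔ (c (g x) (g v) ↔ c x v)) := by
    intro x u v hu hv
    by_cases h : X.JoinedAvoiding x u v
    · rw [hc.congr h, hc.congr (h.map g)]
    · rw [hc.alternate hu hv h, hc.alternate (g.injective.ne hu) (g.injective.ne hv)
        (mt (joinedAvoiding_map_iff g).1 h)]
      tauto
  obtain ⟨p⟩ := hX.preconnected x y
  induction p generalizing v with
  | nil => exact hsame hv hw
  | @cons a b d h q ih =>
    rw [hsame hv h.ne.symm, hc.comm h.ne h.unseparated, hc.comm (g.injective.ne h.ne)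
      (h.unseparated.map g)]
    exact ih h.ne hw

theorem mem_colorStabilizer (hc : X.IsFlagColoring c) (hX : X.Connected) {g : X ≃g X} {x v : V}
    (hv : v ≠ x)
    (h : c (g x) (g v) ↔ c x v) : g ∈ X.colorStabilizer c :=
  fun _ _ hw => (hc.keeps_iff hX g hv hw).1 h

theorem mem_of_fixesFlag (hc : X.IsFlagColoring c) (hX : X.Connected) {g : X ≃g X} {x v : V}
    (h : FixesFlag g x v) :
    g ∈ X.colorStabilizer c := by
  refine hc.mem_colorStabilizer hX h.2.ne_left ?_
  rw [h.1, hc.congr h.2]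

/-- The two sides of `x` have different colours, so `g` cannot exchange them. -/
theorem fixesFlag_of_mem (hc : X.IsFlagColoring c) {g : X ≃g X} (hg : g ∈ X.colorStabilizer c)
    {x v : V} (hv : v ≠ x)
    (hx : g x = x) : FixesFlag g x v := by
  refine ⟨hx, ?_⟩
  by_contra h
  have hgv : g v ≠ x := fun h' => hv (g.injective (h'.trans hx.symm))
  have h1 := hc.alternate hv hgv h
  have h2 := hg x v hv
  rw [hx] at h2
  tauto

/-- If all automorphisms kept colours, lying together in a block of one fixed colour would be
invariant; but both colours occur at `x`, so it is neither trivial nor full. -/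
theorem exists_notMem (hc : X.IsFlagColoring c) (hprim : X.IsPrimitive) (hX : X.Connected)
    (hcut : X.AllCut) :
    ∃ g : X ≃g X, g ∉ X.colorStabilizer c := by
  by_contra! hall
  obtain ⟨x⟩ := hX.nonempty
  obtain ⟨a, b, ha, hb, hab⟩ := hcut x
  obtain ⟨u, hxu, hua⟩ := exists_adj_joinedAvoiding hX ha
  obtain ⟨v, hxv, hvb⟩ := exists_adj_joinedAvoiding hX hb
  have huv : ¬ X.JoinedAvoiding x u v := fun h => hab (hua.symm.trans (h.trans hvb))
  have halt := hc.alternate hxu.ne.symm hxv.ne.symm huv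
  refine (hprim.eq_or_forall_unseparated hX (fun u v => u = v ∨ X.Unseparated u v ∧ c u v)
    (fun u => .inl rfl) ?_ ?_ ?_ ?_).elim (fun h => ?_) (fun h => ?_)
  · rintro u v (h | ⟨h, hcuv⟩)
    · exact .inl h.symm
    · by_cases huv : u = v
      · exact .inl huv.symm
      · exact .inr ⟨h.symm, (hc.comm huv h).1 hcuv⟩
  · rintro u v w (rfl | ⟨huv, hcuv⟩) hvw huw
    · exact hvw
    rcases hvw with rfl | ⟨hvw, hcvw⟩
    · exact .inr ⟨huv, hcuv⟩
    by_cases huw' : u = w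
    · exact .inl huw'
    by_cases huv' : u = v
    · subst huv'
      exact .inr ⟨hvw, hcvw⟩
    exact .inr ⟨huw, (hc.congr (hvw u huv' huw')).1 hcuv⟩
  · rintro u v (rfl | h)
    · exact .refl _
    · exact h.1
  · rintro g u v (rfl | ⟨h, hcuv⟩)
    · exact .inl rfl
    by_cases huv : u = v
    · exact .inl (huv ▸ rfl)
    · exact .inr ⟨h.map g, (hall g u v (Ne.symm huv)).2 hcuv⟩
  · by_cases hcu : c x u
    · exact hxu.ne (h x u (.inr ⟨hxu.unseparated, hcu⟩))
    · exact hxv.ne (h x v (.inr ⟨hxv.unseparated, by tauto⟩))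
  · have h1 := ((h x u hxu.unseparated).resolve_left hxu.ne).2
    have h2 := ((h x v hxv.unseparated).resolve_left hxv.ne).2
    tauto

theorem index_colorStabilizer (hc : X.IsFlagColoring c) (hprim : X.IsPrimitive)
    (hX : X.Connected) (hcut : X.AllCut) :
    (X.colorStabilizer c).index = 2 := by
  obtain ⟨a, ha⟩ := hc.exists_notMem hprim hX hcut
  obtain ⟨x⟩ := hX.nonempty
  obtain ⟨v, -, hv, -⟩ := hcut x
  have hmem : ∀ (g : X ≃g X) x v, v ≠ x →
      (g ∈ X.colorStabilizer c ↔ (c (g x) (g v) ↔ c x v)) := fun g x v hv =>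
    ⟨fun h => h x v hv, hc.mem_colorStabilizer hX hv⟩
  refine Subgroup.index_eq_two_iff.2 ⟨a, fun b => ?_⟩
  have hav := a.injective.ne hv
  have h3 := (hmem a x v hv).not.1 ha
  rw [hmem (b * a) x v hv, hmem b (a x) (a v) hav, RelIso.mul_apply, RelIso.mul_apply]
  unfold Xor
  tauto

/-- An element taking `x` to `y` maps their block to a block at `y` of the same colour, and there is
only one. -/
theorem blockTransitive (hc : X.IsFlagColoring c)
    (htrans : ∀ x y, ∃ g ∈ X.colorStabilizer c, g x = y) :
    BlockTransitive (X.colorStabilizer c) := by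
  intro x y hxy hns
  obtain ⟨γ, hγ, hγx⟩ := htrans x y
  refine ⟨γ, hγ, hγx, fun t => ?_⟩
  have hne : γ y ≠ y := fun h => hxy (γ.injective (hγx.trans h.symm))
  have hyγ : X.Unseparated y (γ y) := hγx ▸ hns.map γ
  have hj : X.JoinedAvoiding y x (γ y) := by
    by_contra h
    have h1 := hc.alternate hxy hne h
    have h2 := hγ x y hxy.symm
    rw [hγx, hc.comm hxy hns] at h2
    tauto
  refine map_mem_blockSet_iff_of_mem γ hxy hxy (left_mem_blockSet hns) (right_mem_blockSet hns)
    (by rw [hγx]; exact right_mem_blockSet hns) ⟨hns.symm.of_joinedAvoiding hyγ hj, hyγ⟩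

end IsFlagColoring

/-! ### Existence of a nontrivial edge stabilizer -/

/-- The automorphisms that preserve a set of vertices. -/
def setStabilizer (X : SimpleGraph V) (S : Set V) : Subgroup (X ≃g X) where
  carrier := {g | ∀ t, g t ∈ S ↔ t ∈ S}
  one_mem' := fun _ => Iff.rfl
  mul_mem' := fun {g h} hg hh t => (hg (h t)).trans (hh t)
  inv_mem' := fun {g} hg t => by rw [← hg, RelIso.apply_inv_self]

theorem IsGate.map {x y p v : V} (h : X.IsGate x y p v) {g : X ≃g X}
    (hg : g ∈ X.setStabilizer (X.blockSet x y)) : X.IsGate x y (g p) (g v) := by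
  refine ⟨(hg p).2 h.1, fun t ht hj => h.2 (g⁻¹ t) ?_ ?_⟩
  · exact (Subgroup.inv_mem _ hg t).2 ht
  · simpa using hj.map g⁻¹

/-- If only the identity fixes an edge of the block tree, then an automorphism that preserves a
block without fixing it pointwise generates a transitive group on the block. -/
theorem exists_zpow_apply_eq (hprim : X.IsPrimitive) (hX : X.Connected) (hcut : X.AllCut)
    (hfree : ∀ (g : X ≃g X) x v, FixesFlag g x v → g = 1) {x z : V} (hxz : x ≠ z)
    (hns : X.Unseparated x z) {a : X ≃g X} (ha : a ∈ X.setStabilizer (X.blockSet x z))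
    (hax : a x = z) (w : V) (hw : w ∈ X.blockSet x z) : ∃ k : ℤ, (a ^ k) x = w := by
  have hxB := left_mem_blockSet hns
  have hzB := right_mem_blockSet hns
  have hpow : ∀ k : ℤ, a ^ k ∈ X.setStabilizer (X.blockSet x z) := fun k =>
    Subgroup.zpow_mem _ ha k
  have hone : ∀ g : X ≃g X, g x = x → ∀ t ∈ X.blockSet x z, t ≠ x → g t ∈ X.blockSet x z →
      g = 1 := by
    intro g hgx t ht htx hgt
    refine hfree g x t ⟨hgx, unseparated_of_mem_blockSet hxz ht hgt x htx.symm fun h => htx ?_⟩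
    exact g.injective (h.symm.trans hgx.symm)
  -- The relation consists of the translates of pairs in the orbit of `x` under the powers of `a`.
  refine (hprim.eq_or_forall_unseparated hX
    (fun u v => ∃ (g : X ≃g X) (k : ℤ), u = g x ∧ v = g ((a ^ k) x)) ?_ ?_ ?_ ?_ ?_).elim
    (fun h => ?_) (fun h => ?_)
  · intro u
    obtain ⟨g, hg⟩ := hprim.exists_apply_eq hX hcut x u
    exact ⟨g, 0, hg.symm, by simp [hg]⟩
  · rintro _ _ ⟨g, k, rfl, rfl⟩
    exact ⟨g * a ^ k, -k, rfl, by simp [RelIso.mul_apply]⟩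
  · rintro u v w ⟨g, k, hu, hv⟩ ⟨g', j, hv', hw⟩ huw
    by_cases huv : u = v
    · exact ⟨g', j, huv.trans hv', hw⟩
    by_cases hvw : v = w
    · exact ⟨g, k, hu, hvw ▸ hv⟩
    have hvw' : X.Unseparated v w := by
      rw [hv', hw]
      exact ((hpow j x).2 hxB).1.map g'
    have hwB : g⁻¹ w ∈ X.blockSet x z := by
      rw [← map_mem_blockSet_iff g, RelIso.apply_inv_self]
      have hxg : g x ∈ X.blockSet (g x) (g z) := (map_mem_blockSet_iff g).2 hxB
      have hvg : v ∈ X.blockSet (g x) (g z) := hv ▸ (map_mem_blockSet_iff g).2 ((hpow k x).2 hxB)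
      rw [← blockSet_eq_of_mem (g.injective.ne hxz) (hu ▸ huv) hxg hvg]
      exact ⟨hu ▸ huw, hvw'⟩
    -- Both `g * a ^ k` and `g'` take `x` to `v` and map the block to the same block, so freeness
    -- makes them equal.
    have hg' : (g * a ^ k)⁻¹ * g' = 1 := by
      refine hone _ ?_ ((a ^ j) x) ((hpow j x).2 hxB) ?_ ?_
      · rw [RelIso.mul_apply, ← hv', hv, ← RelIso.mul_apply g, RelIso.inv_apply_self]
      · intro h
        rw [h, ← hv'] at hw
        exact hvw hw.symm
      · rw [RelIso.mul_apply, ← hw, mul_inv_rev, RelIso.mul_apply]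
        exact (Subgroup.inv_mem _ (hpow k) _).2 hwB
    rw [inv_mul_eq_one] at hg'
    refine ⟨g, k + j, hu, ?_⟩
    rw [hw, ← hg', zpow_add]
    rfl
  · rintro _ _ ⟨g, k, rfl, rfl⟩
    exact ((hpow k x).2 hxB).1.map g
  · rintro g _ _ ⟨g', k, rfl, rfl⟩
    exact ⟨g * g', k, rfl, rfl⟩
  · exact absurd (h x z ⟨1, 1, rfl, by simp [hax]⟩) hxz
  · by_cases hwx : w = x
    · exact ⟨0, by simp [hwx]⟩
    obtain ⟨g, k, hgx, hgw⟩ := h x w hw.1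
    have hg : g = 1 := by
      refine hone g hgx.symm _ ((hpow k x).2 hxB) ?_ (hgw ▸ hw)
      intro h
      rw [h, ← hgx] at hgw
      exact hwx hgw
    exact ⟨k, by simp [hgw, hg]⟩

/-- Inversion of a block on which the powers of `a` act regularly extends to an automorphism. -/
theorem exists_automorphism_inversion (hX : X.Connected) {x z : V} (hxz : x ≠ z)
    (hns : X.Unseparated x z) {a : X ≃g X} (ha : a ∈ X.setStabilizer (X.blockSet x z))
    (hcyc : ∀ w ∈ X.blockSet x z, ∃ k : ℤ, (a ^ k) x = w)
    (hreg : ∀ k : ℤ, (a ^ k) x = x → a ^ k = 1) :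
    ∃ f : X ≃g X, ∀ k : ℤ, f ((a ^ k) x) = (a ^ (-k)) x := by
  have hpow : ∀ k : ℤ, a ^ k ∈ X.setStabilizer (X.blockSet x z) := fun k =>
    Subgroup.zpow_mem _ ha k
  have hinj : ∀ i j : ℤ, (a ^ i) x = (a ^ j) x → a ^ i = a ^ j := by
    intro i j hij
    rw [← mul_inv_eq_one, ← zpow_neg, ← zpow_add, add_comm]
    refine hreg _ ?_
    rw [zpow_add, RelIso.mul_apply, hij, zpow_neg, RelIso.inv_apply_self]
  have hgate : ∀ v, ∃ k : ℤ, X.IsGate x z ((a ^ k) x) v := by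
    intro v
    obtain ⟨p, hp⟩ := exists_isGate hX hxz hns v
    obtain ⟨k, rfl⟩ := hcyc p hp.1
    exact ⟨k, hp⟩
  choose k hk using hgate
  have hkpow : ∀ v (i : ℤ), X.IsGate x z ((a ^ i) x) v → a ^ k v = a ^ i := fun v i hi =>
    hinj _ _ ((hk v).eq hX hi)
  -- All that hangs at `(a ^ k) x` is moved by `a ^ (-2k)`, which takes this vertex to `(a ^ (-k))
  -- x`.
  let φ : V → V := fun v => (a ^ (k v))⁻¹ ((a ^ (k v))⁻¹ v)
  have hφk : ∀ v, a ^ k (φ v) = (a ^ k v)⁻¹ := by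
    intro v
    rw [← zpow_neg]
    refine hkpow _ _ ?_
    have h := ((hk v).map (Subgroup.inv_mem _ (hpow (k v)))).map
      (Subgroup.inv_mem _ (hpow (k v)))
    rw [RelIso.inv_apply_self] at h
    rw [zpow_neg]
    exact h
  have hinv : ∀ v, φ (φ v) = v := by
    intro v
    change (a ^ k (φ v))⁻¹ ((a ^ k (φ v))⁻¹ (φ v)) = v
    rw [hφk, inv_inv]
    simp [φ]
  have hpt : ∀ i : ℤ, φ ((a ^ i) x) = (a ^ (-i)) x := by
    intro i
    have : a ^ k ((a ^ i) x) = a ^ i :=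
      hkpow _ _ (isGate_self ((hpow i x).2 (left_mem_blockSet hns)))
    simp only [φ, this, RelIso.inv_apply_self, zpow_neg]
  have hhom : ∀ u v, X.Adj u v → X.Adj (φ u) (φ v) := by
    intro u v huv
    by_cases he : (a ^ k u) x = (a ^ k v) x
    · have := hinj _ _ he
      simp only [φ, this]
      exact (RelIso.map_rel_iff _).2 ((RelIso.map_rel_iff _).2 huv)
    · have hu := (hk u).eq_of_unseparated hX huv.unseparated (hk v) he
      have hv := (hk v).eq_of_unseparated hX huv.symm.unseparated (hk u) (Ne.symm he)
      generalize k u = i at hu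
      generalize k v = j at hv
      subst hu hv
      rw [hpt, hpt]
      -- This power maps the edge to its inverted image with the ends exchanged.
      have h := (a ^ (-(i + j))).map_adj_iff.2 huv
      rw [← RelIso.mul_apply, ← RelIso.mul_apply, ← zpow_add, ← zpow_add] at h
      have e1 : -(i + j) + i = -j := by ring
      have e2 : -(i + j) + j = -i := by ring
      rw [e1, e2] at h
      exact h.symm
  obtain ⟨f, hf⟩ := exists_automorphism φ φ hinv hinv hhom hhom
  exact ⟨f, fun i => (hf _).trans (hpt i)⟩

/-- Some nontrivial automorphism fixes an edge of the block tree. -/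
theorem exists_fixesFlag_ne_one (hprim : X.IsPrimitive) (hX : X.Connected) (hcut : X.AllCut) :
    ∃ (g : X ≃g X) (x v : V), FixesFlag g x v ∧ g ≠ 1 := by
  by_contra! hfree
  obtain ⟨x⟩ := hX.nonempty
  obtain ⟨u, -, hu, -⟩ := hcut x
  obtain ⟨z, hxz, -⟩ := exists_adj_joinedAvoiding hX hu
  have hns := hxz.unseparated
  obtain ⟨a, -, hax, ha'⟩ := hprim.blockTransitive hX hcut x z hxz.ne hns
  have ha : a ∈ X.setStabilizer (X.blockSet x z) := ha'
  have hxB := left_mem_blockSet hns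
  have hzB := right_mem_blockSet hns
  have hpow : ∀ k : ℤ, a ^ k ∈ X.setStabilizer (X.blockSet x z) := fun k =>
    Subgroup.zpow_mem _ ha k
  have hone : ∀ g : X ≃g X, g x = x → g z ∈ X.blockSet x z → g = 1 := by
    intro g hgx hgz
    refine hfree g x z ⟨hgx, unseparated_of_mem_blockSet hxz.ne hzB hgz x hxz.ne fun h => ?_⟩
    exact hxz.ne (g.injective (hgx.trans h))
  have hcyc := exists_zpow_apply_eq hprim hX hcut hfree hxz.ne hns ha hax
  -- The inversion `f` fixes `x` and keeps `z` in the block, so it is the identity. Hence `a ^ 2 =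
  -- 1` and the block has only the vertices `x` and `z`.
  obtain ⟨f, hf⟩ := exists_automorphism_inversion hX hxz.ne hns ha hcyc
    fun k hk => hone _ hk ((hpow k z).2 hzB)
  have hfx : f x = x := by simpa using hf 0
  have hfz : f z = a⁻¹ x := by simpa [hax] using hf 1
  have hf1 : f = 1 := hone f hfx (hfz ▸ (Subgroup.inv_mem _ ha x).2 hxB)
  have haz : a z = x := by
    have : z = a⁻¹ x := by simpa [hf1] using hfz
    rw [this, RelIso.apply_inv_self]
  have ha2 : a ^ 2 = 1 := hone _ (by rw [pow_two, RelIso.mul_apply, hax, haz])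
    (by rw [pow_two, RelIso.mul_apply, haz, hax]; exact hzB)
  obtain ⟨w, hw, hwx, hwz⟩ := hprim.thickBlocks hX hcut x z hxz.ne hns
  obtain ⟨k, rfl⟩ := hcyc w hw
  rcases Int.even_or_odd' k with ⟨m, rfl | rfl⟩
  · exact hwx (by simp [zpow_mul, ha2])
  · exact hwz (by simp [zpow_add, zpow_mul, ha2, hax])

/-! ### Simplicity of the subgroup of index two -/

/-- If each vertex deletion leaves exactly two components, then `Aut X` has a simple subgroup of
index two. -/
theorem exists_simple_index_two (hprim : X.IsPrimitive) (hX : X.Connected)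
    (hcut : X.AllCut) (htwo : X.TwoSided) :
    ∃ N : Subgroup (X ≃g X), N.Normal ∧ N.index = 2 ∧ IsSimpleGroup N := by
  obtain ⟨c, hc⟩ := exists_isFlagColoring hX hcut htwo
  set Γ := X.colorStabilizer c with hΓ
  have hindex : Γ.index = 2 := hc.index_colorStabilizer hprim hX hcut
  refine ⟨Γ, Subgroup.normal_of_index_eq_two hindex, hindex, ?_⟩
  -- `M` is normal in the full automorphism group, so primitivity makes it transitive; since `M ≤
  -- Γ`, so is `Γ`.
  let M : Subgroup (X ≃g X) := Subgroup.closure {g | ∃ x v, FixesFlag g x v}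
  obtain ⟨g₀, x₀, v₀, hg₀, hg₀'⟩ := exists_fixesFlag_ne_one hprim hX hcut
  have hMne : M ≠ ⊥ := fun h => hg₀' (by
    have : g₀ ∈ M := Subgroup.subset_closure ⟨x₀, v₀, hg₀⟩
    rwa [h, Subgroup.mem_bot] at this)
  have hMnormal : M.Normal := by
    refine Subgroup.Normal.mk fun n hn k => ?_
    induction hn using Subgroup.closure_induction with
    | mem g hg =>
      obtain ⟨x, v, hgx, hgv⟩ := hg
      refine Subgroup.subset_closure ⟨k x, k v, ?_, ?_⟩
      · simp [RelIso.mul_apply, hgx]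
      · simpa [RelIso.mul_apply] using hgv.map k
    | one => simp
    | mul g h _ _ ihg ihh => simpa [mul_assoc] using M.mul_mem ihg ihh
    | inv g _ ih => simpa [mul_assoc] using M.inv_mem ih
  have hMtrans := hprim.exists_mem_apply_eq hMnormal hMne
  have hMΓ : M ≤ Γ := (Subgroup.closure_le _).2 fun g ⟨x, v, hg⟩ => hc.mem_of_fixesFlag hX hg
  have hΓtrans : ∀ x y, ∃ g ∈ Γ, g x = y := fun x y => by
    obtain ⟨g, hg, hgx⟩ := hMtrans x y
    exact ⟨g, hMΓ hg, hgx⟩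
  have : Nontrivial Γ := ⟨⟨g₀, hc.mem_of_fixesFlag hX hg₀⟩, 1, fun h =>
    hg₀' (congrArg Subtype.val h)⟩
  refine ⟨fun N hN => or_iff_not_imp_left.2 fun hNbot => ?_⟩
  let N' : Subgroup (X ≃g X) := N.map Γ.subtype
  have hnorm : ∀ γ ∈ Γ, ∀ n ∈ N', γ * n * γ⁻¹ ∈ N' := by
    rintro γ hγ _ ⟨n, hn, rfl⟩
    exact ⟨_, hN.conj_mem n hn ⟨γ, hγ⟩, rfl⟩
  have hmove : ∀ x, ∃ h ∈ N', h x ≠ x := by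
    intro x
    -- A vertex fixed by all of `N'` would make every vertex fixed, as `Γ` is transitive and
    -- normalizes `N'`.
    by_contra! hfix
    refine hNbot ((Subgroup.eq_bot_iff_forall N).2 fun n hn => Subtype.ext ?_)
    ext y
    obtain ⟨γ, hγ, rfl⟩ := hΓtrans x y
    have := hfix _ (hnorm γ⁻¹ (Γ.inv_mem hγ) n ⟨n, hn, rfl⟩)
    rw [inv_inv, RelIso.mul_apply, RelIso.mul_apply, ← γ.injective.eq_iff,
      RelIso.apply_inv_self] at this
    exact this
  have hflag : ∀ (g : X ≃g X) x v, FixesFlag g x v → g ∈ N' := fun g x v hg =>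
    mem_of_fixesFlag hX hnorm hcut (fun _ _ _ h => hc.mem_of_fixesFlag hX h)
      (hprim.thickBlocks hX hcut) (hc.blockTransitive hΓtrans) hmove hg
  have hMN : M ≤ N' := (Subgroup.closure_le _).2 fun g ⟨x, v, hg⟩ => hflag g x v hg
  refine (Subgroup.eq_top_iff' N).2 fun g => ?_
  obtain ⟨v, -, hv, -⟩ := hcut x₀
  -- Up to an element of `M ≤ N'`, `g` fixes `x₀`; as an element of `Γ` it then fixes a flag.
  obtain ⟨m, hm, hmx⟩ := hMtrans x₀ (g.1 x₀)
  have h1 : m⁻¹ * g.1 ∈ N' := by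
    refine hflag _ x₀ v (hc.fixesFlag_of_mem (Γ.mul_mem (Γ.inv_mem (hMΓ hm)) g.2) hv ?_)
    rw [RelIso.mul_apply, ← hmx, RelIso.inv_apply_self]
  have h2 : g.1 ∈ N' := by simpa using N'.mul_mem (hMN hm) h1
  obtain ⟨n, hn, hng⟩ := h2
  have : n = g := Subtype.ext hng
  exact this ▸ hn

end SimpleGraph

theorem corollary14 {V : Type*} (X : SimpleGraph V)
    (hprim : X.IsPrimitive) (hconn : X.HasConnectivityOne) :
    ((∀ x : V, 2 < (X.blocksAt x).encard) → IsSimpleGroup (X ≃g X)) ∧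
    ((∀ x : V, (X.blocksAt x).encard = 2) →
      ∃ N : Subgroup (X ≃g X), N.Normal ∧ N.index = 2 ∧ IsSimpleGroup N) := by
  have hX := hconn.1
  constructor
  · intro h
    exact SimpleGraph.isSimpleGroup_of_three_components hprim hX
      (SimpleGraph.allCut_of_one_lt_encard hX fun x => lt_trans (by norm_num) (h x))
      fun x u v hu hv => SimpleGraph.exists_third_of_two_lt_encard hX (h x) hu hv
  · intro h
    exact SimpleGraph.exists_simple_index_two hprim hX
      (SimpleGraph.allCut_of_one_lt_encard hX fun x => by rw [h x]; norm_num)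
      fun x u v w hu hv hw huv =>
        SimpleGraph.joinedAvoiding_or_of_encard_le_two hX (h x).le hu hv hw huv
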